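/- Let $\alpha\le 1$, $\rho>0$, $J_0>0$, $M_0\ge 0$, $\Omega\ge 0$, and consider the one-dimensional viscoelastic medium with density $\rho$ and the Jeffreys–Lomnitz–Strick creep compliance $$J_{\alpha,\Omega}(t)=\begin{cases}J_0+M_0\,\dfrac{(1+\Omega t)^{\alpha}-1}{\alpha},&\alpha\ne 0,\\[1ex] J_0+M_0\ln(1+\Omega t),&\alpha=0,\end{cases}\qquad t\ge 0 .$$ For $\mathrm{Re}\,p>0$ put $\kappa(p)=\rho^{1/2}\,p\,[\,p\,\widetilde{J_{\alpha,\Omega}}(p)]^{1/2}$, where $\widetilde{f}(p)=\int_0^\infty e^{-pt}f(t)\,dt$ and the square root is the principal one. Put $c_0=(\rho J_0)^{-1/2}$ and $$N=\frac{M_0\,\Omega}{2\,c_0\,J_0}<\infty .$$ (i) There is a positive measure $\nu$ on $]0,\infty[$, the attenuation–dispersion measure, with $\int_{]0,\infty[}\frac{\nu(dr)}{1+r}<\infty$ and $$\kappa(p)=\frac{p}{c_0}+p\int_{]0,\infty[}\frac{\nu(dr)}{p+r}\qquad(\mathrm{Re}\,p>0).$$ (ii) Every such $\nu$ has finite total mass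 $\nu(]0,\infty[)=N$. Hence the attenuation function $\mathcal A(\omega)=\omega^2\int_{]0,\infty[}\frac{\nu(dr)}{r^2+\omega^2}$ satisfies $\lim_{\omega\to\infty}\mathcal A(\omega)=N$ and is bounded, $0\le\mathcal A(\omega)\le N$ for all real $\omega$, and the function $g(t)=\int_{]0,\infty[}e^{-rt}\,\nu(dr)$, $t>0$, has the finite limit $g(0+)=N$. (iii) Jump discontinuities propagate at the wavefront $|x|=c_0t$. Let $\mathcal G(t,x)$ be the Green's function of the medium, i.e. the solution with zero initial data of $\rho\,u_{tt}=(G*u_{tx})_x+\delta(x)\,\delta(t)$, with $G$ determined by $\int_0^tG(s)\,J_{\alpha,\Omega}(t-s)\,ds=t$, as given by the Laplace inversion formula $$\mathcal G(t,x)=\frac{1}{2\pi i}\int_{\varepsilon-i\infty}^{\varepsilon+i\infty}\frac{\kappa(p)}{2\rho\,p^2}\,e^{pt-\kappa(p)|x|}\,dp .$$ For all real $t,x$ and all $\varepsilon>0$ the integral converges as the limit of the integrals over $[\varepsilon-iR,\varepsilon+iR]$ for $R\to\infty$, with a real value that does not depend on $\varepsilon$. For every real $x$, $\mathcal G(t,x)=0$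 for $t<|x|/c_0$, while $$\lim_{t\to|x|/c_0+0}\mathcal G(t,x)=\frac{1}{2\rho c_0}\,e^{-N|x|}=\frac{1}{2\rho c_0}\,e^{-g(0+)|x|}>0 .$$ -/

import Mathlib

/-- The Jeffreys–Lomnitz–Strick creep compliance `J_{α,Ω}(t)`, for `t ≥ 0`. -/
noncomputable def jlsCompliance (α J₀ M₀ Ω t : ℝ) : ℝ :=
  if α = 0 then J₀ + M₀ * Real.log (1 + Ω * t)
  else J₀ + M₀ * (((1 + Ω * t) ^ α - 1) / α)

/-- The Laplace transform `∫₀^∞ exp (-p t) f(t) dt` of a real function of `t > 0`. -/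
noncomputable def laplaceT (f : ℝ → ℝ) (p : ℂ) : ℂ :=
  ∫ t in Set.Ioi (0 : ℝ), Complex.exp (-p * (t : ℂ)) * (f t : ℂ)

/-- The wavenumber function `κ(p) = ρ^{1/2} p [p J̃(p)]^{1/2}` (principal square root, `Re p > 0`)
of a medium with density `ρ` and creep compliance `J`. -/
noncomputable def wavenumber (ρ : ℝ) (J : ℝ → ℝ) (p : ℂ) : ℂ :=
  (Real.sqrt ρ : ℂ) * p * (p * laplaceT J p) ^ (1 / 2 : ℂ)

/-- The wavefront speed `c₀ = (ρ J₀)^{-1/2}`. -/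
noncomputable def wavefrontSpeed (ρ J₀ : ℝ) : ℝ := (Real.sqrt (ρ * J₀))⁻¹

/-- `ν` is the attenuation–dispersion measure belonging to the wavenumber function `κ` and the
wavefront speed `c₀`: a positive measure on `]0,∞[` with `∫ ν(dr)/(1+r) < ∞` and
`κ(p) = p/c₀ + p ∫ ν(dr)/(p+r)`. -/
structure IsAttenuationMeasure (κ : ℂ → ℂ) (c₀ : ℝ) (ν : MeasureTheory.Measure ℝ) : Prop where
  concentrated : ν (Set.Iic 0) = 0
  integrability : ∫⁻ r in Set.Ioi (0 : ℝ), ENNReal.ofReal (1 / (1 + r)) ∂ν < ⊤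
  representation : ∀ p : ℂ, 0 < p.re →
    κ p = p / (c₀ : ℂ) + p * ∫ r in Set.Ioi (0 : ℝ), 1 / (p + (r : ℂ)) ∂ν

/-- The attenuation function `𝒜(ω) = ω² ∫ ν(dr)/(r²+ω²)`. -/
noncomputable def attenuation (ν : MeasureTheory.Measure ℝ) (ω : ℝ) : ℝ :=
  ω ^ 2 * ∫ r in Set.Ioi (0 : ℝ), 1 / (r ^ 2 + ω ^ 2) ∂ν

/-- The function `g(t) = ∫ exp (-r t) ν(dr)`, for `t > 0`. -/
noncomputable def relaxationKernel (ν : MeasureTheory.Measure ℝ) (t : ℝ) : ℝ :=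
  ∫ r in Set.Ioi (0 : ℝ), Real.exp (-r * t) ∂ν

/-- `u` is the Green's function of the one-dimensional medium with density `ρ` and wavenumber
function `κ`, i.e. the solution with zero initial data of
`ρ u_tt = (G ∗ u_tx)_x + δ(x) δ(t)`, where `G` is the relaxation modulus dual to `J`. It is
given by inversion of its Laplace transform `κ(p) exp (-κ(p)|x|) / (2 ρ p²)` with respect to `t`:
`u(t,x) = (1 / 2πi) ∫ κ(p) / (2 ρ p²) exp (p t - κ(p)|x|) dp` over the line `Re p = ε`, for every
`ε > 0`. The integral converges only conditionally and is the limit of the integrals over the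
segments `[ε - iR, ε + iR]`; below, `p = ε + i y`, `dp = i dy`. -/
def IsGreenFunction (ρ : ℝ) (κ : ℂ → ℂ) (u : ℝ → ℝ → ℝ) : Prop :=
  ∀ ε : ℝ, 0 < ε → ∀ t x : ℝ,
    Filter.Tendsto
      (fun R : ℝ => (1 / (2 * Real.pi) : ℂ) * ∫ y in (-R)..R,
        κ (ε + y * Complex.I) / (2 * ρ * (ε + y * Complex.I) ^ 2) *
          Complex.exp ((ε + y * Complex.I) * t - κ (ε + y * Complex.I) * |x|))
      Filter.atTop (nhds (u t x : ℂ))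

/-! The derivative of the compliance is `m (1 + Ω t) ^ (α - 1)` with `m = M₀ Ω`. For `α < 1` this
power is the Laplace transform of a gamma law scaled by `Ω`, and for `α = 1` of a Dirac mass; both
are probability measures `γ` on `[0,∞[` with finite first moment. Integration by parts turns `p
J̃(p)` into `Q(p) = J₀ + m S(p)`, with `S` the Stieltjes transform of `γ`
(`mul_laplaceT_jlsCompliance`). Only this form of `Q` is used afterwards.

Existence of `ν`: since `p Q(p)` maps the slit plane into itself, `(z² Q(z²))^{1/2}` is holomorphic
with nonnegative real part for `Re z > 0`. A Herglotz representation on the positive reals, built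
from the Poisson formula and weak compactness, writes `√Q(x)` as an integral of `1 / (1 + (x - 1)
b)` over `b ∈ [0,1]`. With `r = 1/b - 1` this is the kernel `(1 + r) / (x + r)`; the atom at `b = 0`
is the elastic term `p / c₀`, and `b = 1` carries no mass. The identity theorem extends the formula
to the half-plane.

Total mass: `x ∫ ν(dr)/(x+r)` increases to `ν(]0,∞[)` as `x → ∞`, and it equals `√ρ x (√Q(x) -
√J₀)`, which tends to `N`. The limits of `𝒜` and `g` are then dominated convergence.

Wavefront: put `q(p) = κ(p) - p/c₀`. The finite first moment of `γ` gives `q = N + O(1/p)`, so that,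
apart from the delay `|x|/c₀`, the transform of the Green's function is `C/p + O(1/p²)` with `C =
e^{-N|x|}/(2ρc₀)`. The term `C/p` inverts to a step of height `C`. The remainder inverts to a
continuous function that vanishes before the front, hence also at it
(`exists_inverse_laplace_remainder`). -/

open MeasureTheory Set Filter Topology

/-! ### Stieltjes transforms of measures on the half-line -/

/-- The Stieltjes transform `∫ γ(ds) / (p + s)`. -/
noncomputable def stieltjesT (γ : Measure ℝ) (p : ℂ) : ℂ := ∫ s, 1 / (p + (s : ℂ)) ∂γ

theorem norm_le_norm_add_ofReal {p : ℂ} (hp : 0 ≤ p.re) {s : ℝ} (hs : 0 ≤ s) :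
    ‖p‖ ≤ ‖p + (s : ℂ)‖ := by
  rw [← sq_le_sq₀ (norm_nonneg _) (norm_nonneg _), Complex.sq_norm, Complex.sq_norm,
    Complex.normSq_apply, Complex.normSq_apply]
  simp
  nlinarith [mul_nonneg hp hs]

theorem add_ofReal_ne_zero_of_mem_slitPlane {p : ℂ} (hp : p ∈ Complex.slitPlane) {s : ℝ}
    (hs : 0 ≤ s) : p + (s : ℂ) ≠ 0 := by
  intro h
  have h1 := congrArg Complex.re h
  have h2 := congrArg Complex.im h
  simp at h1 h2
  rcases hp with hp | hp
  · linarith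
  · exact hp h2

theorem measurable_one_div_add_ofReal (p : ℂ) : Measurable fun s : ℝ => 1 / (p + (s : ℂ)) :=
  Measurable.const_div (measurable_const.add Complex.measurable_ofReal) _

theorem infDist_slitPlane_compl_le {p : ℂ} {s : ℝ} (hs : 0 ≤ s) :
    Metric.infDist p Complex.slitPlaneᶜ ≤ ‖p + (s : ℂ)‖ := by
  have : (-(s : ℂ)) ∈ Complex.slitPlaneᶜ := by
    simp [Complex.mem_slitPlane_iff, hs]
  refine (Metric.infDist_le_dist_of_mem this).trans_eq ?_
  rw [dist_eq_norm, sub_neg_eq_add]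

theorem infDist_slitPlane_compl_pos {p : ℂ} (hp : p ∈ Complex.slitPlane) :
    0 < Metric.infDist p Complex.slitPlaneᶜ := by
  have hc : IsClosed (Complex.slitPlaneᶜ) := Complex.isOpen_slitPlane.isClosed_compl
  have hne : (Complex.slitPlaneᶜ).Nonempty := ⟨0, by simp⟩
  exact (hc.notMem_iff_infDist_pos hne).1 (by simpa using hp)

theorem integrable_one_div_add {γ : Measure ℝ} [IsFiniteMeasure γ] (hγ : ∀ᵐ s ∂γ, 0 ≤ s) {p : ℂ}
    (hp : p ∈ Complex.slitPlane) : Integrable (fun s : ℝ => 1 / (p + (s : ℂ))) γ := by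
  refine Integrable.of_bound (measurable_one_div_add_ofReal p).aestronglyMeasurable
    (1 / Metric.infDist p Complex.slitPlaneᶜ) ?_
  filter_upwards [hγ] with s hs
  rw [norm_div, norm_one]
  exact one_div_le_one_div_of_le (infDist_slitPlane_compl_pos hp) (infDist_slitPlane_compl_le hs)

theorem differentiableOn_stieltjesT {γ : Measure ℝ} [IsFiniteMeasure γ] (hγ : ∀ᵐ s ∂γ, 0 ≤ s) :
    DifferentiableOn ℂ (stieltjesT γ) Complex.slitPlane := by
  intro p hp
  set d := Metric.infDist p Complex.slitPlaneᶜ with hd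
  have hdp : 0 < d := infDist_slitPlane_compl_pos hp
  -- On the ball of half the distance to the cut, the denominators stay away from zero uniformly in
  -- `s`, so a constant dominates the derivatives.
  have key : ∀ q ∈ Metric.ball p (d / 2), ∀ s : ℝ, 0 ≤ s → d / 2 ≤ ‖q + (s : ℂ)‖ := by
    intro q hq s hs
    have h1 : d ≤ Metric.infDist q Complex.slitPlaneᶜ + dist p q := Metric.infDist_le_infDist_add_dist
    have h2 := infDist_slitPlane_compl_le (p := q) hs
    rw [Metric.mem_ball, dist_comm] at hq
    linarith
  have := (hasDerivAt_integral_of_dominated_loc_of_deriv_le (𝕜 := ℂ) (μ := γ)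
    (F := fun q (s : ℝ) => 1 / (q + (s : ℂ))) (F' := fun q (s : ℝ) => -1 / (q + (s : ℂ)) ^ 2)
    (bound := fun _ => 1 / (d / 2) ^ 2) (x₀ := p)
    (Metric.ball_mem_nhds p (half_pos hdp))
    (Eventually.of_forall fun q => (measurable_one_div_add_ofReal q).aestronglyMeasurable)
    (integrable_one_div_add hγ hp)
    (Measurable.aestronglyMeasurable (by fun_prop)) ?_ (integrable_const _) ?_).2
  · exact this.differentiableAt.differentiableWithinAt
  · filter_upwards [hγ] with s hs q hq
    rw [norm_div, norm_neg, norm_one, norm_pow]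
    have := key q hq s hs
    gcongr
  · filter_upwards [hγ] with s hs q hq
    have h0 : q + (s : ℂ) ≠ 0 := by
      have := key q hq s hs
      rw [← norm_pos_iff]; linarith [half_pos hdp]
    have := ((hasDerivAt_id' q).add_const (s : ℂ)).inv h0
    simp only [one_div]
    exact this

theorem norm_mul_stieltjesT_le {γ : Measure ℝ} [IsProbabilityMeasure γ] (hγ : ∀ᵐ s ∂γ, 0 ≤ s)
    {p : ℂ} (hp : 0 < p.re) : ‖p * stieltjesT γ p‖ ≤ 1 := by
  have hp0 : p ≠ 0 := by rintro rfl; simp at hp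
  have h : ‖stieltjesT γ p‖ ≤ 1 / ‖p‖ := by
    have := norm_integral_le_of_norm_le_const (μ := γ) (f := fun s : ℝ => 1 / (p + (s : ℂ)))
      (C := 1 / ‖p‖) ?_
    · simpa [stieltjesT] using this
    · filter_upwards [hγ] with s hs
      rw [norm_div, norm_one]
      exact one_div_le_one_div_of_le (norm_pos_iff.2 hp0) (norm_le_norm_add_ofReal hp.le hs)
  rw [norm_mul]
  calc ‖p‖ * ‖stieltjesT γ p‖ ≤ ‖p‖ * (1 / ‖p‖) := by gcongr
    _ = 1 := by field_simp

/-- Integrate `p/(p+s) - 1 = -s/(p+s)`. The first moment is what buys the rate `1/p`; a finite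
measure alone would only give convergence. -/
theorem norm_mul_stieltjesT_sub_one_le {γ : Measure ℝ} [IsProbabilityMeasure γ]
    (hγ : ∀ᵐ s ∂γ, 0 ≤ s) (h1 : Integrable (fun s : ℝ => s) γ) {p : ℂ} (hp : 0 < p.re) :
    ‖p * stieltjesT γ p - 1‖ ≤ (∫ s, s ∂γ) / ‖p‖ := by
  have hp0 : p ≠ 0 := by rintro rfl; simp at hp
  have hps : p ∈ Complex.slitPlane := Or.inl hp
  have e : p * stieltjesT γ p - 1 = ∫ s : ℝ, (p * (1 / (p + (s : ℂ))) - 1) ∂γ := by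
    rw [integral_sub ((integrable_one_div_add hγ hps).const_mul p) (integrable_const _),
      integral_const_mul]
    simp [stieltjesT]
  rw [e, ← integral_div]
  refine norm_integral_le_of_norm_le (h1.div_const _) ?_
  filter_upwards [hγ] with s hs
  have h0 := add_ofReal_ne_zero_of_mem_slitPlane hps hs
  have : p * (1 / (p + (s : ℂ))) - 1 = -(s : ℂ) / (p + s) := by field_simp; ring
  rw [this, norm_div, norm_neg, Complex.norm_real, Real.norm_of_nonneg hs]
  have := norm_pos_iff.2 hp0
  gcongr
  exact norm_le_norm_add_ofReal hp.le hs

theorem stieltjesT_conj (γ : Measure ℝ) (p : ℂ) :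
    stieltjesT γ ((starRingEnd ℂ) p) = (starRingEnd ℂ) (stieltjesT γ p) := by
  rw [stieltjesT, stieltjesT, ← integral_conj]
  simp

theorem re_stieltjesT_nonneg {γ : Measure ℝ} [IsFiniteMeasure γ] (hγ : ∀ᵐ s ∂γ, 0 ≤ s) {p : ℂ}
    (hp : 0 < p.re) : 0 ≤ (stieltjesT γ p).re := by
  have hi := integrable_one_div_add hγ (p := p) (Or.inl hp)
  have : (stieltjesT γ p).re = ∫ s : ℝ, (1 / (p + (s : ℂ))).re ∂γ :=
    (Complex.reCLM.integral_comp_comm hi).symm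
  rw [this]
  refine integral_nonneg_of_ae ?_
  filter_upwards [hγ] with s hs
  simp only [one_div, Complex.inv_re, Complex.add_re, Complex.ofReal_re, Pi.zero_apply]
  exact div_nonneg (by linarith) (Complex.normSq_nonneg _)

/-- Pointwise, `Im (p/(p+s)) = s Im p / |p+s|²` has the sign of `Im p`. This keeps `p Q(p)` off the
cut. -/
theorem mul_im_mul_stieltjesT_nonneg {γ : Measure ℝ} [IsFiniteMeasure γ] (hγ : ∀ᵐ s ∂γ, 0 ≤ s)
    {p : ℂ} (hp : p ∈ Complex.slitPlane) : 0 ≤ p.im * (p * stieltjesT γ p).im := by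
  have hi := (integrable_one_div_add hγ hp).const_mul (p.im * p)
  have e : p.im * (p * stieltjesT γ p).im = ∫ s : ℝ, ((p.im * p) * (1 / (p + (s : ℂ)))).im ∂γ := by
    have : (∫ s : ℝ, ((p.im * p) * (1 / (p + (s : ℂ)))) ∂γ).im = _ :=
      (Complex.imCLM.integral_comp_comm hi).symm
    simp only [Complex.imCLM_apply] at this
    rw [← this, integral_const_mul, mul_assoc, Complex.im_ofReal_mul]
    rfl
  rw [e]
  refine integral_nonneg_of_ae ?_
  filter_upwards [hγ] with s hs
  have h0 := Complex.normSq_pos.2 (add_ofReal_ne_zero_of_mem_slitPlane hp hs)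
  have : ((p.im * p) * (1 / (p + (s : ℂ)))).im = p.im ^ 2 * s / Complex.normSq (p + s) := by
    rw [one_div, mul_assoc, Complex.im_ofReal_mul, Complex.mul_im, Complex.inv_re, Complex.inv_im]
    simp
    field_simp
    ring
  rw [this, Pi.zero_apply]
  positivity

theorem stieltjesT_ofReal (γ : Measure ℝ) (x : ℝ) :
    stieltjesT γ x = ((∫ s, 1 / (x + s) ∂γ : ℝ) : ℂ) := by
  rw [stieltjesT, ← integral_complex_ofReal]
  simp

/-! ### The Laplace transform of the compliance -/

/-- The Gamma integral with shape `1 - α` and rate `1`, evaluated at `Ω t`; the measure is that law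
pushed forward by `s ↦ Ω s`. At `α = 1` the shape degenerates and the Dirac mass at `0` takes over.
-/
theorem exists_measure_laplace_rpow {α Ω : ℝ} (hα : α ≤ 1) (hΩ : 0 ≤ Ω) :
    ∃ γ : Measure ℝ, IsProbabilityMeasure γ ∧ (∀ᵐ s ∂γ, 0 ≤ s) ∧ Integrable (fun s : ℝ => s) γ ∧
      ∀ t : ℝ, 0 ≤ t → ∫ s, Real.exp (-t * s) ∂γ = (1 + Ω * t) ^ (α - 1) := by
  rcases hα.eq_or_lt with rfl | hα
  · refine ⟨Measure.dirac 0, inferInstance, ?_, ?_, ?_⟩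
    · rw [ae_dirac_eq]; simp
    · exact integrable_dirac (by simp)
    · intro t _; simp
  have ha : 0 < 1 - α := by linarith
  set a := 1 - α with ha_def
  have hprob := ProbabilityTheory.isProbabilityMeasure_gammaMeasure ha one_pos
  have hm : Measurable fun s : ℝ => Ω * s := by fun_prop
  have hG : 0 < Real.Gamma a := Real.Gamma_pos_of_pos ha
  have hfin : ∀ᵐ x : ℝ, ProbabilityTheory.gammaPDF a 1 x < ⊤ :=
    Eventually.of_forall fun x => ENNReal.ofReal_lt_top
  have hmeas : Measurable (ProbabilityTheory.gammaPDF a 1) :=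
    (ProbabilityTheory.measurable_gammaPDFReal a 1).ennreal_ofReal
  have hpdf : ∀ x, (ProbabilityTheory.gammaPDF a 1 x).toReal
      = ProbabilityTheory.gammaPDFReal a 1 x := fun x =>
    ENNReal.toReal_ofReal (ProbabilityTheory.gammaPDFReal_nonneg ha one_pos x)
  have hnn : ∀ᵐ s ∂(ProbabilityTheory.gammaMeasure a 1), 0 ≤ s := by
    rw [ProbabilityTheory.gammaMeasure, ae_withDensity_iff hmeas]
    refine Eventually.of_forall fun s hs => ?_
    by_contra! h
    exact hs (ProbabilityTheory.gammaPDF_of_neg h)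
  have hzero : ∀ g : ℝ → ℝ, ∀ x : ℝ, x ∉ Ici (0 : ℝ) →
      ProbabilityTheory.gammaPDFReal a 1 x * g x = 0 := by
    intro g x hx
    rw [ProbabilityTheory.gammaPDFReal, if_neg (by simpa using hx), zero_mul]
  refine ⟨(ProbabilityTheory.gammaMeasure a 1).map (fun s => Ω * s),
    Measure.isProbabilityMeasure_map hm.aemeasurable, ?_, ?_, ?_⟩
  · rw [ae_map_iff hm.aemeasurable measurableSet_Ici]
    filter_upwards [hnn] with s hs using mul_nonneg hΩ hs
  · rw [integrable_map_measure (by fun_prop) hm.aemeasurable]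
    refine Integrable.const_mul (f := fun s : ℝ => s) ?_ Ω
    rw [ProbabilityTheory.gammaMeasure,
      integrable_withDensity_iff_integrable_smul' hmeas hfin]
    simp only [hpdf, smul_eq_mul]
    rw [← integrableOn_iff_integrable_of_support_subset (s := Ici (0 : ℝ)),
      integrableOn_Ici_iff_integrableOn_Ioi]
    · have := (Real.GammaIntegral_convergent (s := a + 1) (by linarith)).const_mul (1 / Real.Gamma a)
      refine IntegrableOn.congr_fun this (fun x hx => ?_) measurableSet_Ioi
      have hx : 0 < x := hx
      simp only [ProbabilityTheory.gammaPDFReal, if_pos hx.le, Real.one_rpow, one_mul]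
      rw [add_sub_cancel_right, Real.rpow_sub_one hx.ne']
      field_simp
    · intro x hx
      by_contra h
      exact hx (hzero (fun x => x) x h)
  · intro t ht
    have hr : 0 < 1 + Ω * t := by nlinarith [mul_nonneg hΩ ht]
    rw [integral_map hm.aemeasurable (by fun_prop), ProbabilityTheory.gammaMeasure,
      integral_withDensity_eq_integral_toReal_smul hmeas hfin]
    simp only [hpdf, smul_eq_mul]
    rw [← setIntegral_eq_integral_of_forall_compl_eq_zero (s := Ici (0 : ℝ))
      (hzero (fun x => Real.exp (-t * (Ω * x)))), integral_Ici_eq_integral_Ioi]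
    have : ∫ x in Ioi (0 : ℝ), ProbabilityTheory.gammaPDFReal a 1 x * Real.exp (-t * (Ω * x))
        = ∫ x in Ioi (0 : ℝ), 1 / Real.Gamma a * (x ^ (a - 1) * Real.exp (-((1 + Ω * t) * x))) := by
      refine setIntegral_congr_fun measurableSet_Ioi fun x hx => ?_
      have hx : 0 < x := hx
      simp only [ProbabilityTheory.gammaPDFReal, if_pos hx.le, Real.one_rpow, one_mul]
      rw [show -((1 + Ω * t) * x) = -x + -t * (Ω * x) by ring, Real.exp_add]
      ring
    rw [this, integral_const_mul, Real.integral_rpow_mul_exp_neg_mul_Ioi ha hr, one_div (1 + Ω * t),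
      Real.inv_rpow hr.le, ← Real.rpow_neg hr.le, ha_def]
    field_simp
    congr 1; ring

/-- After differentiation the logarithmic case `α = 0` is no longer exceptional, so nothing later
distinguishes it. -/
theorem hasDerivAt_jlsCompliance (α J₀ M₀ : ℝ) {Ω t : ℝ} (ht : 0 < 1 + Ω * t) :
    HasDerivAt (jlsCompliance α J₀ M₀ Ω) (M₀ * Ω * (1 + Ω * t) ^ (α - 1)) t := by
  have h1 : HasDerivAt (fun t : ℝ => 1 + Ω * t) Ω t := by
    simpa using ((hasDerivAt_id' t).const_mul Ω).const_add 1
  by_cases hα : α = 0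
  · have e : jlsCompliance α J₀ M₀ Ω = fun t => J₀ + M₀ * Real.log (1 + Ω * t) := by
      funext t; simp [jlsCompliance, hα]
    rw [e]
    refine (((h1.log ht.ne').const_mul M₀).const_add J₀).congr_deriv ?_
    rw [hα, zero_sub, Real.rpow_neg_one]
    ring
  · have e : jlsCompliance α J₀ M₀ Ω = fun t => J₀ + M₀ * (((1 + Ω * t) ^ α - 1) / α) := by
      funext t; simp [jlsCompliance, hα]
    rw [e]
    refine (((((h1.rpow_const (p := α) (Or.inl ht.ne')).sub_const 1).div_const α).const_mul
      M₀).const_add J₀).congr_deriv ?_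
    field_simp

theorem jlsCompliance_zero (α J₀ M₀ Ω : ℝ) : jlsCompliance α J₀ M₀ Ω 0 = J₀ := by
  simp [jlsCompliance]

theorem abs_jlsCompliance_le {α J₀ M₀ Ω t : ℝ} (hα : α ≤ 1) (hJ₀ : 0 ≤ J₀) (hM₀ : 0 ≤ M₀)
    (hΩ : 0 ≤ Ω) (ht : 0 ≤ t) : |jlsCompliance α J₀ M₀ Ω t| ≤ J₀ + M₀ * Ω * t := by
  have hpos : ∀ u ∈ Icc 0 t, 1 ≤ 1 + Ω * u := fun u hu => by nlinarith [mul_nonneg hΩ hu.1]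
  have := (convex_Icc (0 : ℝ) t).norm_image_sub_le_of_norm_hasDerivWithin_le
    (f := jlsCompliance α J₀ M₀ Ω) (f' := fun u => M₀ * Ω * (1 + Ω * u) ^ (α - 1)) (C := M₀ * Ω)
    (fun u hu => (hasDerivAt_jlsCompliance α J₀ M₀ (by linarith [hpos u hu])).hasDerivWithinAt)
    (fun u hu => by
      have h1 := hpos u hu
      have h2 : (1 + Ω * u) ^ (α - 1) ≤ 1 := Real.rpow_le_one_of_one_le_of_nonpos h1 (by linarith)
      have h3 : 0 ≤ (1 + Ω * u) ^ (α - 1) := by positivity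
      have h4 := mul_nonneg hM₀ hΩ
      rw [Real.norm_of_nonneg (by positivity)]
      nlinarith) (left_mem_Icc.2 ht) (right_mem_Icc.2 ht)
  rw [jlsCompliance_zero, sub_zero, Real.norm_eq_abs, Real.norm_of_nonneg ht] at this
  calc |jlsCompliance α J₀ M₀ Ω t| = |J₀ + (jlsCompliance α J₀ M₀ Ω t - J₀)| := by ring_nf
    _ ≤ |J₀| + |jlsCompliance α J₀ M₀ Ω t - J₀| := abs_add_le _ _
    _ ≤ _ := by rw [abs_of_nonneg hJ₀]; linarith

theorem integral_cexp_mul_laplace_eq_stieltjesT {γ : Measure ℝ} [IsFiniteMeasure γ]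
    (hγ : ∀ᵐ s ∂γ, 0 ≤ s) {p : ℂ} (hp : 0 < p.re) :
    ∫ t in Ioi (0 : ℝ), Complex.exp (-p * t) * ((∫ s, Real.exp (-t * s) ∂γ : ℝ) : ℂ)
      = stieltjesT γ p := by
  have e : ∀ t : ℝ, Complex.exp (-p * t) * ((∫ s, Real.exp (-t * s) ∂γ : ℝ) : ℂ)
      = ∫ s : ℝ, Complex.exp (-(p + s) * t) ∂γ := by
    intro t
    rw [← integral_complex_ofReal, ← integral_const_mul]
    refine integral_congr_ae (Eventually.of_forall fun s => ?_)
    simp only [Complex.ofReal_exp, ← Complex.exp_add]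
    congr 1; push_cast; ring
  simp only [e]
  rw [integral_integral_swap]
  · refine integral_congr_ae ?_
    filter_upwards [hγ] with s hs
    have hre : (-(p + (s : ℂ))).re < 0 := by simp; linarith
    rw [integral_exp_mul_complex_Ioi hre]
    simp only [Complex.ofReal_zero, mul_zero, Complex.exp_zero]
    rw [neg_div_neg_eq]
  · have hb : Integrable (fun z : ℝ × ℝ => Real.exp (-p.re * z.1) * (1 : ℝ))
        ((volume.restrict (Ioi 0)).prod γ) :=
      (exp_neg_integrableOn_Ioi 0 hp).integrable.mul_prod (integrable_const (1 : ℝ))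
    refine hb.mono' (Measurable.aestronglyMeasurable (by fun_prop)) ?_
    have h1 : ∀ᵐ z ∂((volume.restrict (Ioi (0 : ℝ))).prod γ), 0 ≤ z.2 :=
      Measure.quasiMeasurePreserving_snd.ae hγ
    have h2 : ∀ᵐ z ∂((volume.restrict (Ioi (0 : ℝ))).prod γ), z.1 ∈ Ioi (0 : ℝ) :=
      Measure.quasiMeasurePreserving_fst.ae (ae_restrict_mem measurableSet_Ioi)
    filter_upwards [h1, h2] with z hz1 hz2
    have hz2 : 0 < z.1 := hz2
    simp only [Function.uncurry]
    rw [Complex.norm_exp, mul_one]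
    refine Real.exp_le_exp.2 ?_
    simp
    nlinarith [mul_nonneg hz1 hz2.le]

/-- Integration by parts: the boundary term at `0` is `J₀`, the one at infinity vanishes, and the
transform of the derivative is a Stieltjes transform by Fubini. -/
theorem mul_laplaceT_jlsCompliance {α J₀ M₀ Ω : ℝ} (hα : α ≤ 1) (hJ₀ : 0 ≤ J₀) (hM₀ : 0 ≤ M₀)
    (hΩ : 0 ≤ Ω) {γ : Measure ℝ} [IsFiniteMeasure γ] (hγ : ∀ᵐ s ∂γ, 0 ≤ s)
    (hL : ∀ t : ℝ, 0 ≤ t → ∫ s, Real.exp (-t * s) ∂γ = (1 + Ω * t) ^ (α - 1)) {p : ℂ}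
    (hp : 0 < p.re) :
    p * laplaceT (jlsCompliance α J₀ M₀ Ω) p = J₀ + (M₀ * Ω : ℝ) * stieltjesT γ p := by
  set J := jlsCompliance α J₀ M₀ Ω with hJ
  set m := M₀ * Ω with hm
  have hm0 : 0 ≤ m := mul_nonneg hM₀ hΩ
  have h1 : ∀ t : ℝ, 0 ≤ t → 1 ≤ 1 + Ω * t := fun t ht => by nlinarith [mul_nonneg hΩ ht]
  have hderiv : ∀ t : ℝ, 0 ≤ t → HasDerivAt J (m * (1 + Ω * t) ^ (α - 1)) t := fun t ht =>
    hasDerivAt_jlsCompliance α J₀ M₀ (by linarith [h1 t ht])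
  have hcont : ContinuousOn J (Ioi 0) := fun t ht =>
    (hderiv t (le_of_lt ht)).continuousAt.continuousWithinAt
  -- Half of the exponential decay absorbs the linear growth of `J`; the other half remains for
  -- integrability.
  have hσ : 0 < p.re / 2 := half_pos hp
  have hbound : ∀ t : ℝ, 0 < t → ‖Complex.exp (-p * t) * (J t : ℂ)‖
      ≤ (J₀ + m / (p.re / 2)) * Real.exp (-(p.re / 2) * t) := by
    intro t ht
    have ha := abs_jlsCompliance_le hα hJ₀ hM₀ hΩ ht.le
    have he : p.re / 2 * t ≤ Real.exp (p.re / 2 * t) := by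
      linarith [Real.add_one_le_exp (p.re / 2 * t)]
    have he1 : 1 ≤ Real.exp (p.re / 2 * t) := Real.one_le_exp (by positivity)
    have hJt : |J t| ≤ (J₀ + m / (p.re / 2)) * Real.exp (p.re / 2 * t) := by
      have : m * t ≤ m / (p.re / 2) * Real.exp (p.re / 2 * t) := by
        calc m * t = m / (p.re / 2) * (p.re / 2 * t) := by field_simp
          _ ≤ _ := by gcongr
      have := mul_le_mul_of_nonneg_left he1 hJ₀
      rw [add_mul]; linarith
    rw [norm_mul, Complex.norm_exp, Complex.norm_real, Real.norm_eq_abs]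
    have : (-p * (t : ℂ)).re = -p.re * t := by simp
    rw [this]
    calc Real.exp (-p.re * t) * |J t|
        ≤ Real.exp (-p.re * t) * ((J₀ + m / (p.re / 2)) * Real.exp (p.re / 2 * t)) := by gcongr
      _ = (J₀ + m / (p.re / 2)) * (Real.exp (-p.re * t) * Real.exp (p.re / 2 * t)) := by ring
      _ = _ := by rw [← Real.exp_add]; congr 2; ring
  have hmeasJ : AEStronglyMeasurable (fun t : ℝ => Complex.exp (-p * t) * (J t : ℂ))
      (volume.restrict (Ioi 0)) :=
    (ContinuousOn.mul (by fun_prop) (Complex.continuous_ofReal.comp_continuousOn hcont)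
      ).aestronglyMeasurable measurableSet_Ioi
  have hint1 : IntegrableOn (fun t : ℝ => Complex.exp (-p * t) * (J t : ℂ)) (Ioi 0) := by
    refine ((exp_neg_integrableOn_Ioi 0 hσ).integrable.const_mul (J₀ + m / (p.re / 2))).mono'
      hmeasJ ?_
    filter_upwards [ae_restrict_mem measurableSet_Ioi] with t ht using hbound t ht
  have hint2 : IntegrableOn (fun t : ℝ => Complex.exp (-p * t) *
      ((m * (1 + Ω * t) ^ (α - 1) : ℝ) : ℂ)) (Ioi 0) := by
    refine ((exp_neg_integrableOn_Ioi 0 hp).integrable.mul_const m).mono' ?_ ?_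
    · refine ContinuousOn.aestronglyMeasurable (ContinuousOn.mul (by fun_prop)
        (Complex.continuous_ofReal.comp_continuousOn ?_)) measurableSet_Ioi
      refine continuousOn_const.mul (ContinuousOn.rpow_const (by fun_prop) ?_)
      intro t ht
      exact Or.inl (by linarith [h1 t (le_of_lt ht)])
    · filter_upwards [ae_restrict_mem measurableSet_Ioi] with t ht
      have h1t := h1 t (le_of_lt ht)
      have h2 : (1 + Ω * t) ^ (α - 1) ≤ 1 := Real.rpow_le_one_of_one_le_of_nonpos h1t (by linarith)
      have h3 : 0 ≤ (1 + Ω * t) ^ (α - 1) := by positivity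
      rw [norm_mul, Complex.norm_exp, Complex.norm_real, Real.norm_of_nonneg (by positivity)]
      have : (-p * (t : ℂ)).re = -p.re * t := by simp
      rw [this]
      gcongr
      nlinarith
  have hparts := integral_Ioi_mul_deriv_eq_deriv_mul (A := ℂ) (a := 0)
    (u := fun t : ℝ => Complex.exp (-p * t)) (v := fun t : ℝ => (J t : ℂ))
    (u' := fun t : ℝ => Complex.exp (-p * t) * -p)
    (v' := fun t : ℝ => ((m * (1 + Ω * t) ^ (α - 1) : ℝ) : ℂ)) (a' := (J₀ : ℂ)) (b' := 0)
    (fun t _ => by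
      have : HasDerivAt (fun t : ℝ => -p * (t : ℂ)) (-p) t := by
        simpa using (Complex.ofRealCLM.hasDerivAt (x := t)).const_mul (-p)
      exact this.cexp)
    (fun t ht => (hderiv t (le_of_lt ht)).ofReal_comp) hint2
    (by
      have := hint1.integrable.const_mul (-p)
      refine this.congr (Eventually.of_forall fun t => ?_)
      simp only [Pi.mul_apply]; ring)
    (by
      have hc : ContinuousAt (fun t : ℝ => Complex.exp (-p * t) * (J t : ℂ)) 0 :=
        ContinuousAt.mul (by fun_prop)
          (Complex.continuous_ofReal.continuousAt.comp (hderiv 0 le_rfl).continuousAt)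
      have := hc.tendsto.mono_left (nhdsWithin_le_nhds (s := Ioi 0))
      change Tendsto (fun t : ℝ => Complex.exp (-p * t) * (J t : ℂ)) _ _
      simpa [hJ, jlsCompliance_zero] using this)
    (by
      refine squeeze_zero_norm' (a := fun t => (J₀ + m / (p.re / 2)) * Real.exp (-(p.re / 2) * t))
        ?_ ?_
      · filter_upwards [eventually_gt_atTop 0] with t ht using hbound t ht
      · have : Tendsto (fun t : ℝ => Real.exp (-(p.re / 2) * t)) atTop (𝓝 0) := by
          refine Real.tendsto_exp_atBot.comp ?_
          exact tendsto_id.const_mul_atTop_of_neg (by linarith)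
        simpa using this.const_mul (J₀ + m / (p.re / 2)))
  have hr : ∫ t in Ioi (0 : ℝ), Complex.exp (-p * t) * ((m * (1 + Ω * t) ^ (α - 1) : ℝ) : ℂ)
      = m * stieltjesT γ p := by
    rw [← integral_cexp_mul_laplace_eq_stieltjesT hγ hp, ← integral_const_mul]
    refine setIntegral_congr_fun measurableSet_Ioi fun t ht => ?_
    simp only [hL t (le_of_lt ht)]
    push_cast; ring
  have hl : ∫ t in Ioi (0 : ℝ), Complex.exp (-p * t) * -p * (J t : ℂ) = -(p * laplaceT J p) := by
    rw [laplaceT, ← neg_mul, ← integral_const_mul]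
    refine integral_congr_ae (Eventually.of_forall fun t => ?_)
    simp only; ring
  rw [hr, hl] at hparts
  rw [hparts]; ring

/-! ### A Herglotz representation on the positive reals -/

/-- At a point of the real diameter the Poisson kernel depends on the angle only through `b = (1 -
cos θ)/2`. Boundary measures can therefore be pushed to the unit interval. -/
theorem poissonKernel_circleMap_ofReal (w θ : ℝ) :
    poissonKernel 0 (w : ℂ) (circleMap 0 1 θ)
      = (1 - w ^ 2) / ((1 - w) ^ 2 + 4 * w * ((1 - Real.cos θ) / 2)) := by
  have h : ‖circleMap 0 1 θ - (w : ℂ)‖ ^ 2 = (1 - w) ^ 2 + 4 * w * ((1 - Real.cos θ) / 2) := by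
    rw [Complex.sq_norm, Complex.normSq_apply]
    simp [circleMap, Complex.exp_ofReal_mul_I_re, Complex.exp_ofReal_mul_I_im]
    nlinarith [Real.sin_sq_add_cos_sq θ]
  rw [poissonKernel_def]
  simp only [sub_zero]
  rw [h]
  simp

theorem haversine_mem_unitInterval (θ : ℝ) : (1 - Real.cos θ) / 2 ∈ unitInterval :=
  ⟨by linarith [Real.cos_le_one θ], by linarith [Real.neg_one_le_cos θ]⟩

/-- The denominator is the convex combination of `(1-w)²` and `(1+w)²` with weights `1-b` and `b`.
-/
theorem haversine_denominator_pos {w b : ℝ} (hw : w ∈ Ioo (-1 : ℝ) 1) (hb : b ∈ unitInterval) :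
    0 < (1 - w) ^ 2 + 4 * w * b := by
  have h1 : 0 < (1 - w) ^ 2 := by have := hw.2; nlinarith
  have h2 : 0 < (1 + w) ^ 2 := by have := hw.1; nlinarith
  have e : (1 - w) ^ 2 + 4 * w * b = (1 - b) * (1 - w) ^ 2 + b * (1 + w) ^ 2 := by ring
  rw [e]
  rcases hb.1.eq_or_lt with h | h
  · rw [← h]; simpa using h1
  · have := mul_pos h h2
    have := mul_nonneg (sub_nonneg.2 hb.2) h1.le
    linarith

theorem continuous_haversine_kernel {w : ℝ} (hw : w ∈ Ioo (-1 : ℝ) 1) :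
    Continuous fun b : unitInterval => (1 - w ^ 2) / ((1 - w) ^ 2 + 4 * w * (b : ℝ)) :=
  Continuous.div (by fun_prop) (by fun_prop) fun b => (haversine_denominator_pos hw b.2).ne'

/-- Dilation by `R < 1` makes the function continuous up to the circle, where the Poisson formula
applies; `τ` is the image of the density `Re f(R e^{iθ})/2π`. The mass does not depend on `R`, which
is what the later passage `R → 1` needs. -/
theorem exists_finiteMeasure_haversine_of_re_nonneg {f : ℂ → ℂ}
    (hf : DifferentiableOn ℂ f (Metric.ball 0 1)) (hre : ∀ z ∈ Metric.ball (0 : ℂ) 1, 0 ≤ (f z).re)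
    {R : ℝ} (hR0 : 0 < R) (hR1 : R < 1) :
    ∃ τ : FiniteMeasure unitInterval, τ.mass = (f 0).re.toNNReal ∧ ∀ w ∈ Ioo (-1 : ℝ) 1,
      (f ((R * w : ℝ) : ℂ)).re
        = ∫ b : unitInterval, (1 - w ^ 2) / ((1 - w) ^ 2 + 4 * w * (b : ℝ)) ∂(τ : Measure unitInterval) := by
  set g : ℂ → ℂ := fun ζ => f (R * ζ) with hg
  have hmaps : ∀ ζ ∈ Metric.closedBall (0 : ℂ) 1, (R : ℂ) * ζ ∈ Metric.ball (0 : ℂ) 1 := by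
    intro ζ hζ
    rw [mem_closedBall_zero_iff] at hζ
    rw [mem_ball_zero_iff, norm_mul, Complex.norm_real, Real.norm_of_nonneg hR0.le]
    nlinarith [norm_nonneg ζ]
  have hgc : ContinuousOn g (Metric.closedBall 0 1) :=
    hf.continuousOn.comp (by fun_prop) hmaps
  have hgd : DiffContOnCl ℂ g (Metric.ball 0 1) := by
    refine ⟨hf.comp (by fun_prop) fun ζ hζ => hmaps ζ (Metric.ball_subset_closedBall hζ), ?_⟩
    rwa [closure_ball _ one_ne_zero]
  have hcirc : ∀ θ : ℝ, circleMap 0 1 θ ∈ Metric.closedBall (0 : ℂ) 1 := fun θ =>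
    Metric.sphere_subset_closedBall (circleMap_mem_sphere 0 zero_le_one θ)
  have hgθ : Continuous fun θ : ℝ => g (circleMap 0 1 θ) :=
    hgc.comp_continuous (continuous_circleMap 0 1) hcirc
  set h : ℝ → ℝ := fun θ => (2 * Real.pi)⁻¹ * (g (circleMap 0 1 θ)).re with hh
  have hhc : Continuous h := continuous_const.mul (Complex.continuous_re.comp hgθ)
  have hh0 : ∀ θ, 0 ≤ h θ := fun θ =>
    mul_nonneg (by positivity) (hre _ (hmaps _ (hcirc θ)))
  set φ : ℝ → unitInterval := fun θ => ⟨(1 - Real.cos θ) / 2, haversine_mem_unitInterval θ⟩ with hφ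
  have hφm : Measurable φ := by
    refine Continuous.measurable ?_
    exact Continuous.subtype_mk (by fun_prop) _
  set μ := (volume.restrict (Ioc 0 (2 * Real.pi))).withDensity fun θ => ENNReal.ofReal (h θ) with hμ
  have hhi : Integrable h (volume.restrict (Ioc 0 (2 * Real.pi))) :=
    (hhc.integrableOn_Icc (a := 0) (b := 2 * Real.pi)).mono_set Ioc_subset_Icc_self
  have hμfin : IsFiniteMeasure μ := isFiniteMeasure_withDensity_ofReal hhi.2
  have hfin : IsFiniteMeasure (μ.map φ) := inferInstance
  have hrep : ∀ w ∈ Ioo (-1 : ℝ) 1, (f ((R * w : ℝ) : ℂ)).re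
        = ∫ b : unitInterval, (1 - w ^ 2) / ((1 - w) ^ 2 + 4 * w * (b : ℝ)) ∂(μ.map φ) := by
    intro w hw
    have hwb : (w : ℂ) ∈ Metric.ball (0 : ℂ) 1 := by
      rw [mem_ball_zero_iff, Complex.norm_real, Real.norm_eq_abs, abs_lt]; exact hw
    have hP := hgd.circleAverage_poissonKernel_smul hwb
    have hk := continuous_haversine_kernel hw
    rw [Real.circleAverage_def] at hP
    have hker : Continuous fun θ : ℝ => poissonKernel 0 (w : ℂ) (circleMap 0 1 θ) := by
      simp only [poissonKernel_circleMap_ofReal]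
      exact hk.comp (Continuous.subtype_mk (by fun_prop) haversine_mem_unitInterval)
    have hci : Continuous fun θ : ℝ => (poissonKernel 0 (w : ℂ) • g) (circleMap 0 1 θ) :=
      hker.smul hgθ
    have hP' := congrArg Complex.re hP
    rw [Complex.smul_re, smul_eq_mul, ← Complex.reCLM_apply,
      ← Complex.reCLM.intervalIntegral_comp_comm (hci.intervalIntegrable _ _)] at hP'
    have hgw : g w = f ((R * w : ℝ) : ℂ) := by simp [hg]
    rw [← hgw, ← hP', integral_map hφm.aemeasurable hk.measurable.aestronglyMeasurable, hμ,
      integral_withDensity_eq_integral_toReal_smul hhc.measurable.ennreal_ofReal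
        (Eventually.of_forall fun θ => ENNReal.ofReal_lt_top),
      intervalIntegral.integral_of_le (by positivity), ← integral_const_mul]
    refine integral_congr_ae (Eventually.of_forall fun θ => ?_)
    beta_reduce
    rw [ENNReal.toReal_ofReal (hh0 θ)]
    simp only [Complex.reCLM_apply, Pi.smul_apply', smul_eq_mul,
      Complex.smul_re, hh, poissonKernel_circleMap_ofReal, hφ]
    ring
  refine ⟨⟨μ.map φ, hfin⟩, ?_, hrep⟩
  -- At `w = 0` the kernel is `1`, so the representation reads off the mass.
  have h0 := hrep 0 (by norm_num)
  simp only [mul_zero, Complex.ofReal_zero] at h0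
  norm_num at h0
  rw [h0]
  exact Real.toNNReal_coe.symm

/-- The Herglotz representation on the right half-plane, restricted to the positive reals. -/
theorem exists_measure_unitInterval_of_re_nonneg {F : ℂ → ℂ}
    (hF : DifferentiableOn ℂ F {z | 0 < z.re}) (hre : ∀ z : ℂ, 0 < z.re → 0 ≤ (F z).re) :
    ∃ τ : Measure unitInterval, IsFiniteMeasure τ ∧ ∀ z : ℝ, 0 < z →
      (F z).re = ∫ b : unitInterval, z / (1 + (z ^ 2 - 1) * (b : ℝ)) ∂τ := by
  -- The Cayley transform carries the unit disc to the right half-plane and the real diameter to the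
  -- positive axis.
  set f : ℂ → ℂ := fun w => F ((1 + w) / (1 - w)) with hf
  have hne : ∀ w ∈ Metric.ball (0 : ℂ) 1, 1 - w ≠ 0 := by
    intro w hw h
    rw [mem_ball_zero_iff] at hw
    rw [← sub_eq_zero.1 h] at hw
    simp at hw
  have hmaps : ∀ w ∈ Metric.ball (0 : ℂ) 1, 0 < ((1 + w) / (1 - w)).re := by
    intro w hw
    have h1 := Complex.normSq_pos.2 (hne w hw)
    rw [mem_ball_zero_iff] at hw
    have h2 : Complex.normSq w < 1 := by
      rw [← Complex.sq_norm]; nlinarith [norm_nonneg w]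
    rw [Complex.div_re, ← add_div]
    refine div_pos ?_ h1
    rw [Complex.normSq_apply] at h2
    simp
    nlinarith
  have hfd : DifferentiableOn ℂ f (Metric.ball 0 1) :=
    hF.comp (DifferentiableOn.div (by fun_prop) (by fun_prop) hne) hmaps
  have hfre : ∀ w ∈ Metric.ball (0 : ℂ) 1, 0 ≤ (f w).re := fun w hw => hre _ (hmaps w hw)
  set R : ℕ → ℝ := fun n => 1 - 1 / ((n : ℝ) + 2) with hR
  have hR01 : ∀ n, 0 < R n ∧ R n < 1 := by
    intro n
    have h2 : (0 : ℝ) < (n : ℝ) + 2 := by positivity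
    have : 1 / ((n : ℝ) + 2) < 1 := by
      rw [div_lt_one h2]; have : (0 : ℝ) ≤ n := n.cast_nonneg
      linarith
    have h3 : 0 < 1 / ((n : ℝ) + 2) := by positivity
    constructor <;> simp only [hR] <;> linarith
  have hRlim : Tendsto R atTop (𝓝 1) := by
    have : Tendsto (fun n : ℕ => 1 / ((n : ℝ) + 2)) atTop (𝓝 0) :=
      tendsto_const_nhds.div_atTop
        (tendsto_atTop_add_const_right _ _ tendsto_natCast_atTop_atTop)
    simpa [hR] using this.const_sub 1
  choose τ hmass hτ using fun n =>
    exists_finiteMeasure_haversine_of_re_nonneg hfd hfre (hR01 n).1 (hR01 n).2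
  -- Measures of a fixed mass on a compact space form a weakly compact set; a limit along an
  -- ultrafilter replaces the choice of a convergent subsequence.
  have hcomp := isCompact_setOfPred_finiteMeasure_eq_of_compactSpace unitInterval (f 0).re.toNNReal
  obtain ⟨σ, -, hσ⟩ := hcomp.ultrafilter_le_nhds' ((hyperfilter ℕ).map τ) (by
    rw [Ultrafilter.mem_map]
    exact Filter.univ_mem' hmass)
  have hσ' : Tendsto τ (hyperfilter ℕ) (𝓝 σ) := hσ
  rw [FiniteMeasure.tendsto_iff_forall_integral_tendsto] at hσ'
  refine ⟨σ, inferInstance, fun z hz => ?_⟩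
  set w : ℝ := (z - 1) / (z + 1) with hw
  have hz1 : 0 < z + 1 := by linarith
  have hwI : w ∈ Ioo (-1 : ℝ) 1 := by
    constructor
    · rw [hw, lt_div_iff₀ hz1]; linarith
    · rw [hw, div_lt_one hz1]; linarith
  have hwb : (w : ℂ) ∈ Metric.ball (0 : ℂ) 1 := by
    rw [mem_ball_zero_iff, Complex.norm_real, Real.norm_eq_abs, abs_lt]; exact hwI
  have hlim1 : Tendsto (fun n => (f ((R n * w : ℝ) : ℂ)).re) (hyperfilter ℕ) (𝓝 (f w).re) := by
    have hc : ContinuousAt f w := (hfd.differentiableAt (Metric.isOpen_ball.mem_nhds hwb)).continuousAt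
    have h1 : Tendsto (fun n => ((R n * w : ℝ) : ℂ)) atTop (𝓝 (w : ℂ)) := by
      have := (hRlim.mul_const w)
      rw [one_mul] at this
      exact (Complex.continuous_ofReal.tendsto w).comp this
    exact (Complex.continuous_re.continuousAt.tendsto.comp (hc.tendsto.comp h1)).mono_left
      Nat.hyperfilter_le_atTop
  have hlim2 := hσ' (BoundedContinuousFunction.mkOfCompact ⟨_, continuous_haversine_kernel hwI⟩)
  simp only [BoundedContinuousFunction.mkOfCompact_apply, ContinuousMap.coe_mk] at hlim2
  simp only [hτ _ w hwI] at hlim1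
  have hlim := tendsto_nhds_unique hlim1 hlim2
  have hfw : f w = F z := by
    simp only [hf, hw]
    congr 1
    have : (z : ℂ) + 1 ≠ 0 := by exact_mod_cast hz1.ne'
    push_cast
    field_simp
    ring
  rw [← hfw, hlim]
  refine integral_congr_ae (Eventually.of_forall fun b => ?_)
  have hd1 := haversine_denominator_pos hwI b.2
  have hd2 : 0 < 1 + (z ^ 2 - 1) * (b : ℝ) := by
    have h0 := b.2.1
    have h1 := b.2.2
    rcases h0.eq_or_lt with h | h
    · rw [← h]; norm_num
    · nlinarith [mul_pos h (pow_pos hz 2)]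
  simp only
  -- With `w = (z-1)/(z+1)`, numerator and denominator share the factor `4/(z+1)²`, which leaves `z
  -- / (1 + (z²-1) b)`.
  rw [div_eq_div_iff hd1.ne' hd2.ne', hw]
  field_simp
  ring

/-! ### The square root and the attenuation–dispersion measure -/

/-- The function `J₀ + m ∫ γ(ds) / (p + s)`. -/
noncomputable def affineStieltjes (γ : Measure ℝ) (J₀ m : ℝ) (p : ℂ) : ℂ := J₀ + m * stieltjesT γ p

theorem re_cpow_half_nonneg (z : ℂ) : 0 ≤ (z ^ (1 / 2 : ℂ)).re := by
  by_cases hz : z = 0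
  · simp [hz]
  · rw [Complex.cpow_def_of_ne_zero hz, Complex.exp_re]
    refine mul_nonneg (Real.exp_nonneg _) (Real.cos_nonneg_of_mem_Icc ?_)
    have h : (Complex.log z * (1 / 2)).im = z.arg / 2 := by
      rw [show (1 / 2 : ℂ) = ((1 / 2 : ℝ) : ℂ) by push_cast; rfl, Complex.im_mul_ofReal,
        Complex.log_im]; ring
    rw [h]
    constructor <;> linarith [Complex.neg_pi_lt_arg z, Complex.arg_le_pi z]

theorem ofReal_cpow_half {x : ℝ} (hx : 0 ≤ x) : (x : ℂ) ^ (1 / 2 : ℂ) = (Real.sqrt x : ℂ) := by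
  rw [Real.sqrt_eq_rpow, Complex.ofReal_cpow hx]; push_cast; rfl

theorem cpow_half_sq (z : ℂ) : (z ^ (1 / 2 : ℂ)) ^ 2 = z := by
  rw [one_div]; exact Complex.cpow_ofNat_inv_pow z 2

theorem sq_mem_slitPlane {z : ℂ} (hz : 0 < z.re) : z ^ 2 ∈ Complex.slitPlane := by
  rw [Complex.mem_slitPlane_iff, sq, Complex.mul_re, Complex.mul_im]
  by_cases h : z.im = 0
  · left; rw [h]; nlinarith
  · right
    have : z.re * z.im ≠ 0 := mul_ne_zero hz.ne' h
    intro h0; apply this; linarith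

/-- Off the real axis the imaginary part has the sign of `Im p`, strictly because `J₀ > 0`; on the
positive axis the real part is positive. -/
theorem mul_affineStieltjes_mem_slitPlane {γ : Measure ℝ} [IsFiniteMeasure γ]
    (hγ : ∀ᵐ s ∂γ, 0 ≤ s) {J₀ m : ℝ} (hJ₀ : 0 < J₀) (hm : 0 ≤ m) {p : ℂ}
    (hp : p ∈ Complex.slitPlane) : p * affineStieltjes γ J₀ m p ∈ Complex.slitPlane := by
  have e : p * affineStieltjes γ J₀ m p = J₀ * p + m * (p * stieltjesT γ p) := by
    rw [affineStieltjes]; ring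
  rw [e, Complex.mem_slitPlane_iff]
  by_cases h : p.im = 0
  · left
    have hpr : 0 < p.re := by
      rcases hp with hp | hp
      · exact hp
      · exact absurd h hp
    rw [Complex.add_re, Complex.re_ofReal_mul, Complex.re_ofReal_mul, Complex.mul_re, h]
    have := re_stieltjesT_nonneg hγ hpr
    have h1 := mul_pos hJ₀ hpr
    have h2 := mul_nonneg hm (mul_nonneg hpr.le this)
    linarith
  · right
    rw [Complex.add_im, Complex.im_ofReal_mul, Complex.im_ofReal_mul]
    have h1 := mul_nonneg hm (mul_im_mul_stieltjesT_nonneg hγ hp)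
    have h2 : 0 < J₀ * p.im ^ 2 := by positivity
    intro h0
    have h3 : p.im * (J₀ * p.im + m * (p * stieltjesT γ p).im) = 0 := by rw [h0, mul_zero]
    linarith

theorem re_affineStieltjes_pos {γ : Measure ℝ} [IsFiniteMeasure γ]
    (hγ : ∀ᵐ s ∂γ, 0 ≤ s) {J₀ m : ℝ} (hJ₀ : 0 < J₀) (hm : 0 ≤ m) {p : ℂ}
    (hp : 0 < p.re) : 0 < (affineStieltjes γ J₀ m p).re := by
  rw [affineStieltjes, Complex.add_re, Complex.re_ofReal_mul, Complex.ofReal_re]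
  have := mul_nonneg hm (re_stieltjesT_nonneg hγ hp)
  linarith

theorem differentiableOn_affineStieltjes {γ : Measure ℝ} [IsFiniteMeasure γ]
    (hγ : ∀ᵐ s ∂γ, 0 ≤ s) (J₀ m : ℝ) :
    DifferentiableOn ℂ (affineStieltjes γ J₀ m) Complex.slitPlane :=
  ((differentiableOn_stieltjesT hγ).const_mul _).const_add _

theorem affineStieltjes_ofReal (γ : Measure ℝ) (J₀ m x : ℝ) :
    affineStieltjes γ J₀ m x = ((J₀ + m * ∫ s, 1 / (x + s) ∂γ : ℝ) : ℂ) := by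
  rw [affineStieltjes, stieltjesT_ofReal]; push_cast; rfl

theorem abs_mul_integral_one_div_add_le {γ : Measure ℝ} [IsProbabilityMeasure γ]
    (hγ : ∀ᵐ s ∂γ, 0 ≤ s) {x : ℝ} (hx : 0 < x) : |x * ∫ s, 1 / (x + s) ∂γ| ≤ 1 := by
  have h := norm_mul_stieltjesT_le hγ (p := x) (by simpa using hx)
  rw [stieltjesT_ofReal, ← Complex.ofReal_mul, Complex.norm_real] at h
  exact h

theorem integral_one_div_add_nonneg {γ : Measure ℝ}
    (hγ : ∀ᵐ s ∂γ, 0 ≤ s) {x : ℝ} (hx : 0 < x) : 0 ≤ ∫ s, 1 / (x + s) ∂γ := by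
  refine integral_nonneg_of_ae ?_
  filter_upwards [hγ] with s hs
  simp only [Pi.zero_apply]; positivity

theorem one_add_sub_one_mul_pos {x b : ℝ} (hx : 0 < x) (hb : b ∈ unitInterval) :
    0 < 1 + (x - 1) * b := by
  rcases hb.1.eq_or_lt with h | h
  · rw [← h]; norm_num
  · nlinarith [mul_pos h hx, hb.2]

/-- Squaring maps the half-plane into the slit plane, so the principal root of `z² Q(z²)` is
holomorphic there with nonnegative real part. At `z = √x` its Herglotz formula has a factor `√x` on
both sides, which cancels. -/
theorem exists_measure_unitInterval_sqrt {γ : Measure ℝ} [IsFiniteMeasure γ]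
    (hγ : ∀ᵐ s ∂γ, 0 ≤ s) {J₀ m : ℝ} (hJ₀ : 0 < J₀) (hm : 0 ≤ m) :
    ∃ τ : Measure unitInterval, IsFiniteMeasure τ ∧ ∀ x : ℝ, 0 < x →
      Real.sqrt (J₀ + m * ∫ s, 1 / (x + s) ∂γ) = ∫ b : unitInterval, 1 / (1 + (x - 1) * (b : ℝ)) ∂τ := by
  have hmaps : MapsTo (fun z : ℂ => z ^ 2) {z : ℂ | 0 < z.re} Complex.slitPlane :=
    fun z hz => sq_mem_slitPlane hz
  have hd : DifferentiableOn ℂ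
      (fun z : ℂ => (z ^ 2 * affineStieltjes γ J₀ m (z ^ 2)) ^ (1 / 2 : ℂ)) {z : ℂ | 0 < z.re} :=
    (DifferentiableOn.mul (by fun_prop)
      ((differentiableOn_affineStieltjes hγ J₀ m).comp (by fun_prop) hmaps)).cpow_const
      fun z hz => mul_affineStieltjes_mem_slitPlane hγ hJ₀ hm (hmaps hz)
  obtain ⟨τ, hτ, hrep⟩ := exists_measure_unitInterval_of_re_nonneg hd
    fun z _ => re_cpow_half_nonneg _
  refine ⟨τ, hτ, fun x hx => ?_⟩
  have hz : 0 < Real.sqrt x := Real.sqrt_pos.2 hx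
  have h := hrep _ hz
  have hQ : 0 ≤ J₀ + m * ∫ s, 1 / (x + s) ∂γ :=
    add_nonneg hJ₀.le (mul_nonneg hm (integral_one_div_add_nonneg hγ hx))
  rw [← Complex.ofReal_pow, Real.sq_sqrt hx.le, affineStieltjes_ofReal, ← Complex.ofReal_mul,
    ofReal_cpow_half (mul_nonneg hx.le hQ), Complex.ofReal_re, Real.sqrt_mul hx.le] at h
  refine mul_left_cancel₀ hz.ne' (h.trans ?_)
  rw [← integral_const_mul]
  refine integral_congr_ae (Eventually.of_forall fun b => ?_)
  simp only; ring

/-- As `x → ∞` the kernel tends to the indicator of `b = 0` while `Q(x) → J₀`. This atom produces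
the term `p/c₀`. -/
theorem measureReal_singleton_zero_eq_sqrt {γ : Measure ℝ} [IsProbabilityMeasure γ]
    (hγ : ∀ᵐ s ∂γ, 0 ≤ s) {J₀ m : ℝ} {τ : Measure unitInterval}
    [IsFiniteMeasure τ] (hτ : ∀ x : ℝ, 0 < x →
      Real.sqrt (J₀ + m * ∫ s, 1 / (x + s) ∂γ) = ∫ b : unitInterval, 1 / (1 + (x - 1) * (b : ℝ)) ∂τ) :
    τ.real {0} = Real.sqrt J₀ := by
  have h1 : Tendsto (fun x : ℝ => ∫ b : unitInterval, 1 / (1 + (x - 1) * (b : ℝ)) ∂τ) atTop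
      (𝓝 (∫ b : unitInterval, indicator {0} (fun _ => (1 : ℝ)) b ∂τ)) := by
    refine tendsto_integral_filter_of_dominated_convergence (fun _ => 1)
      (Eventually.of_forall fun x => Measurable.aestronglyMeasurable (by fun_prop)) ?_
      (integrable_const _) (Eventually.of_forall fun b => ?_)
    · filter_upwards [eventually_ge_atTop 1] with x hx
      refine Eventually.of_forall fun b => ?_
      have : 1 ≤ 1 + (x - 1) * (b : ℝ) := by
        have := mul_nonneg (sub_nonneg.2 hx) b.2.1
        linarith
      rw [Real.norm_of_nonneg (by positivity)]
      exact (div_le_one (by linarith)).2 this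
    · by_cases hb : b = 0
      · simp [hb]
      · have hb' : 0 < (b : ℝ) := unitInterval.pos_iff_ne_zero.2 hb
        rw [indicator_of_notMem (by simpa using hb)]
        refine tendsto_const_nhds.div_atTop (tendsto_atTop_add_const_left _ _ ?_)
        exact (tendsto_atTop_add_const_right _ (-1) tendsto_id).atTop_mul_const hb'
  rw [integral_indicator_const _ (measurableSet_singleton _), smul_eq_mul, mul_one] at h1
  have h2 : Tendsto (fun x : ℝ => ∫ s, 1 / (x + s) ∂γ) atTop (𝓝 0) := by
    refine squeeze_zero_norm' (a := fun x : ℝ => x⁻¹) ?_ tendsto_inv_atTop_zero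
    filter_upwards [eventually_gt_atTop 0] with x hx
    have := abs_mul_integral_one_div_add_le hγ hx
    rw [abs_mul, abs_of_pos hx] at this
    rw [Real.norm_eq_abs, ← one_div, le_div_iff₀ hx]
    linarith
  have h3 : Tendsto (fun x : ℝ => Real.sqrt (J₀ + m * ∫ s, 1 / (x + s) ∂γ)) atTop
      (𝓝 (Real.sqrt J₀)) := by
    have := (Real.continuous_sqrt.tendsto _).comp ((h2.const_mul m).const_add J₀)
    simpa [Function.comp_def] using this
  refine tendsto_nhds_unique h1 (h3.congr' ?_)
  filter_upwards [eventually_gt_atTop 0] with x hx using hτ x hx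

/-- As `x → 0+`, `x` times the kernel tends to the indicator of `b = 1`, while `x √Q(x) ≤ √(x² J₀ +
m x) → 0`. An atom here would be mass of `ν` at `r = 0`. -/
theorem measureReal_singleton_one_eq_zero {γ : Measure ℝ} [IsProbabilityMeasure γ]
    (hγ : ∀ᵐ s ∂γ, 0 ≤ s) {J₀ m : ℝ} (hm : 0 ≤ m) {τ : Measure unitInterval}
    [IsFiniteMeasure τ] (hτ : ∀ x : ℝ, 0 < x →
      Real.sqrt (J₀ + m * ∫ s, 1 / (x + s) ∂γ) = ∫ b : unitInterval, 1 / (1 + (x - 1) * (b : ℝ)) ∂τ) :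
    τ.real {1} = 0 := by
  have h1 : Tendsto (fun x : ℝ => ∫ b : unitInterval, x * (1 / (1 + (x - 1) * (b : ℝ))) ∂τ) (𝓝[>] 0)
      (𝓝 (∫ b : unitInterval, indicator {1} (fun _ => (1 : ℝ)) b ∂τ)) := by
    refine tendsto_integral_filter_of_dominated_convergence (fun _ => 1)
      (Eventually.of_forall fun x => Measurable.aestronglyMeasurable (by fun_prop)) ?_
      (integrable_const _) (Eventually.of_forall fun b => ?_)
    · filter_upwards [Ioo_mem_nhdsGT (zero_lt_one' ℝ)] with x hx
      refine Eventually.of_forall fun b => ?_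
      have h0 := one_add_sub_one_mul_pos hx.1 b.2
      have : x ≤ 1 + (x - 1) * (b : ℝ) := by
        nlinarith [mul_nonneg (sub_nonneg.2 hx.2.le) (sub_nonneg.2 b.2.2)]
      rw [mul_one_div, Real.norm_of_nonneg (div_nonneg hx.1.le h0.le)]
      exact (div_le_one h0).2 this
    · by_cases hb : b = 1
      · rw [indicator_of_mem (by simpa using hb)]
        refine tendsto_const_nhds.congr' ?_
        filter_upwards [self_mem_nhdsWithin] with x hx
        have hx : 0 < x := hx
        rw [show (b : ℝ) = 1 by rw [hb]; rfl, show 1 + (x - 1) * 1 = x by ring, mul_one_div,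
          div_self hx.ne']
      · have hb' : (b : ℝ) < 1 := unitInterval.lt_one_iff_ne_one.2 hb
        rw [indicator_of_notMem (by simpa using hb)]
        have hc : ContinuousAt (fun x : ℝ => x * (1 / (1 + (x - 1) * (b : ℝ)))) 0 := by
          refine continuousAt_id.mul (ContinuousAt.div (by fun_prop) (by fun_prop) ?_)
          linarith
        simpa using hc.tendsto.mono_left (nhdsWithin_le_nhds (s := Ioi 0))
  rw [integral_indicator_const _ (measurableSet_singleton _), smul_eq_mul, mul_one] at h1
  have h3 : Tendsto (fun x : ℝ => Real.sqrt (x ^ 2 * (J₀ + m * ∫ s, 1 / (x + s) ∂γ))) (𝓝[>] 0)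
      (𝓝 0) := by
    have h4 : Tendsto (fun x : ℝ => x ^ 2 * J₀ + m * x) (𝓝[>] 0) (𝓝 0) := by
      have hc : Continuous fun x : ℝ => x ^ 2 * J₀ + m * x := by fun_prop
      simpa using (hc.tendsto 0).mono_left (nhdsWithin_le_nhds (s := Ioi 0))
    have h5 := (Real.continuous_sqrt.tendsto _).comp h4
    rw [Real.sqrt_zero] at h5
    refine squeeze_zero' (Eventually.of_forall fun x => Real.sqrt_nonneg _) ?_ h5
    filter_upwards [self_mem_nhdsWithin] with x hx
    have hx : 0 < x := hx
    refine Real.sqrt_le_sqrt ?_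
    have h6 := (abs_le.1 (abs_mul_integral_one_div_add_le hγ hx)).2
    have h7 := mul_le_mul_of_nonneg_left h6 (mul_nonneg hm hx.le)
    nlinarith
  refine tendsto_nhds_unique h1 (h3.congr' ?_)
  filter_upwards [self_mem_nhdsWithin] with x hx
  have hx : 0 < x := hx
  rw [integral_const_mul, ← hτ x hx, Real.sqrt_mul (by positivity), Real.sqrt_sq hx.le]

theorem eqOn_re_pos_of_eq_ofReal {f g : ℂ → ℂ} (hf : DifferentiableOn ℂ f {z | 0 < z.re})
    (hg : DifferentiableOn ℂ g {z | 0 < z.re}) (h : ∀ x : ℝ, 0 < x → f x = g x) :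
    EqOn f g {z | 0 < z.re} := by
  have ho : IsOpen {z : ℂ | 0 < z.re} := isOpen_lt continuous_const Complex.continuous_re
  have hc : IsPreconnected {z : ℂ | 0 < z.re} := (convex_halfSpace_re_gt 0).isPreconnected
  refine (hf.analyticOnNhd ho).eqOn_of_preconnected_of_frequently_eq (hg.analyticOnNhd ho) hc
    (z₀ := 1) (by simp) ?_
  have h1 : Tendsto (fun n : ℕ => ((1 + 1 / ((n : ℝ) + 1) : ℝ) : ℂ)) atTop (𝓝[≠] 1) := by
    refine tendsto_nhdsWithin_iff.2 ⟨?_, Eventually.of_forall fun n => ?_⟩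
    · have := (tendsto_one_div_add_atTop_nhds_zero_nat (𝕜 := ℝ)).const_add 1
      rw [add_zero] at this
      simpa [Function.comp_def] using (Complex.continuous_ofReal.tendsto _).comp this
    · have : (0 : ℝ) < 1 / ((n : ℝ) + 1) := by positivity
      simp only [mem_compl_iff, mem_singleton_iff]
      rw [Complex.ofReal_eq_one]
      linarith
  exact h1.frequently (Eventually.of_forall fun n => h _ (by positivity)).frequently

theorem inv_wavefrontSpeed (ρ J₀ : ℝ) : (wavefrontSpeed ρ J₀)⁻¹ = Real.sqrt (ρ * J₀) := by
  rw [wavefrontSpeed, inv_inv]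

/-- With `r = 1/b - 1`, the kernel `1/(1+(x-1)b)` becomes `(1+r)/(x+r)`. Hence `ν` is the image of
`τ` on the open interval with density `√ρ (1+r)`, and the integrability condition is just finiteness
of `τ`. -/
theorem exists_isAttenuationMeasure {γ : Measure ℝ} [IsProbabilityMeasure γ]
    (hγ : ∀ᵐ s ∂γ, 0 ≤ s) {ρ J₀ m : ℝ} (hρ : 0 < ρ) (hJ₀ : 0 < J₀) (hm : 0 ≤ m) {κ : ℂ → ℂ}
    (hκ : ∀ p : ℂ, 0 < p.re →
      κ p = Real.sqrt ρ * p * (affineStieltjes γ J₀ m p) ^ (1 / 2 : ℂ)) :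
    ∃ ν : Measure ℝ, IsAttenuationMeasure κ (wavefrontSpeed ρ J₀) ν := by
  obtain ⟨τ, hτfin, hτ⟩ := exists_measure_unitInterval_sqrt hγ hJ₀ hm
  have hτ0 := measureReal_singleton_zero_eq_sqrt hγ hτ
  have hτ1 := measureReal_singleton_one_eq_zero hγ hm hτ
  set φ : unitInterval → ℝ := fun b => 1 / (b : ℝ) - 1 with hφ
  have hφm : Measurable φ := by fun_prop
  set T : Set unitInterval := Ioo 0 1 with hT
  set σ : Measure ℝ := (τ.restrict T).map φ with hσ
  have hσpos : ∀ᵐ r ∂σ, 0 < r := by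
    rw [hσ, ae_map_iff hφm.aemeasurable measurableSet_Ioi]
    filter_upwards [ae_restrict_mem measurableSet_Ioo] with b hb
    have h0 : 0 < (b : ℝ) := hb.1
    have h1 : (b : ℝ) < 1 := hb.2
    have : 1 < 1 / (b : ℝ) := by rw [lt_div_iff₀ h0]; linarith
    simp only [hφ]; linarith
  have hσfin : IsFiniteMeasure σ := inferInstance
  have hσ0 : ∀ᵐ r ∂σ, 0 ≤ r := hσpos.mono fun r hr => hr.le
  set w : ℝ → ENNReal := fun r => ENNReal.ofReal (Real.sqrt ρ * (1 + r)) with hw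
  have hwm : Measurable w := by fun_prop
  have hsρ : 0 < Real.sqrt ρ := Real.sqrt_pos.2 hρ
  set ν : Measure ℝ := σ.withDensity w with hν
  have hνpos : ∀ᵐ r ∂ν, r ∈ Ioi (0 : ℝ) := (withDensity_absolutelyContinuous σ w).ae_le hσpos
  have hνr : ν.restrict (Ioi 0) = ν := Measure.restrict_eq_self_of_ae_mem hνpos
  -- From `(1+r)/(p+r) = 1 + (1-p)/(p+r)`: the possibly infinite `ν` is traded for the finite `σ`,
  -- whose Stieltjes transform is known to be holomorphic.
  have hint : ∀ p : ℂ, 0 < p.re → ∫ r in Ioi (0 : ℝ), 1 / (p + (r : ℂ)) ∂ν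
      = Real.sqrt ρ * (σ.real univ + (1 - p) * stieltjesT σ p) := by
    intro p hp
    have hps : p ∈ Complex.slitPlane := Or.inl hp
    rw [hνr, hν, integral_withDensity_eq_integral_toReal_smul hwm
      (Eventually.of_forall fun r => ENNReal.ofReal_lt_top)]
    have : ∀ᵐ r : ℝ ∂σ, (w r).toReal • (1 / (p + (r : ℂ)))
        = Real.sqrt ρ * (1 + (1 - p) * (1 / (p + (r : ℂ)))) := by
      filter_upwards [hσpos] with r hr
      have h0 := add_ofReal_ne_zero_of_mem_slitPlane hps hr.le
      rw [hw, ENNReal.toReal_ofReal (by positivity), Complex.real_smul]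
      push_cast
      field_simp
      ring
    rw [integral_congr_ae this, integral_const_mul, integral_add (integrable_const _)
      ((integrable_one_div_add hσ0 hps).const_mul _), integral_const_mul, integral_const]
    simp [stieltjesT]
  have hreal : ∀ x : ℝ, 0 < x → Real.sqrt (J₀ + m * ∫ s, 1 / (x + s) ∂γ)
      = Real.sqrt J₀ + (σ.real univ + (1 - x) * ∫ r, 1 / (x + r) ∂σ) := by
    intro x hx
    have hi1 : Integrable (fun r : ℝ => 1 / (x + r)) σ := by
      refine Integrable.of_bound (Measurable.aestronglyMeasurable (by fun_prop)) (1 / x) ?_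
      filter_upwards [hσ0] with r hr
      rw [Real.norm_of_nonneg (by positivity)]
      exact one_div_le_one_div_of_le hx (by linarith)
    have e1 : σ.real univ + (1 - x) * ∫ r, 1 / (x + r) ∂σ
        = ∫ b in T, 1 / (1 + (x - 1) * (b : ℝ)) ∂τ := by
      have : ∫ r, (1 + (1 - x) * (1 / (x + r))) ∂σ
          = σ.real univ + (1 - x) * ∫ r, 1 / (x + r) ∂σ := by
        rw [integral_add (integrable_const _) (hi1.const_mul _), integral_const_mul, integral_const]
        simp
      rw [← this, hσ, integral_map hφm.aemeasurable
        (Measurable.aestronglyMeasurable (by fun_prop))]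
      refine setIntegral_congr_fun measurableSet_Ioo fun b hb => ?_
      have h0 : 0 < (b : ℝ) := hb.1
      have h1 := one_add_sub_one_mul_pos hx b.2
      have h2 : x + (1 / (b : ℝ) - 1) = (1 + (x - 1) * b) / b := by field_simp; ring
      simp only [hφ, h2]
      field_simp
      ring
    have hcont : Continuous fun b : unitInterval => 1 / (1 + (x - 1) * (b : ℝ)) :=
      Continuous.div (by fun_prop) (by fun_prop) fun b => (one_add_sub_one_mul_pos hx b.2).ne'
    have hi : Integrable (fun b : unitInterval => 1 / (1 + (x - 1) * (b : ℝ))) τ :=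
      (BoundedContinuousFunction.mkOfCompact ⟨_, hcont⟩).integrable τ
    have e2 : ∫ b in {0}ᶜ, 1 / (1 + (x - 1) * (b : ℝ)) ∂τ
        = ∫ b in T, 1 / (1 + (x - 1) * (b : ℝ)) ∂τ := by
      refine setIntegral_congr_set ?_
      have hnull : τ {1} = 0 := (measureReal_eq_zero_iff).1 hτ1
      have : ∀ᵐ b ∂τ, b ≠ 1 := by
        rw [ae_iff]; simpa using hnull
      filter_upwards [this] with b hb
      refine propext ⟨fun h => ?_, fun h => ?_⟩
      · exact ⟨unitInterval.pos_iff_ne_zero.2 h, unitInterval.lt_one_iff_ne_one.2 hb⟩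
      · exact h.1.ne'
    rw [hτ x hx, e1, ← e2, ← integral_add_compl (measurableSet_singleton (0 : unitInterval)) hi,
      integral_singleton]
    simp [hτ0]
  have hanal : EqOn (fun p => affineStieltjes γ J₀ m p ^ (1 / 2 : ℂ))
      (fun p => Real.sqrt J₀ + (σ.real univ + (1 - p) * stieltjesT σ p)) {p | 0 < p.re} := by
    have hsub : {p : ℂ | 0 < p.re} ⊆ Complex.slitPlane := fun p hp => Or.inl hp
    refine eqOn_re_pos_of_eq_ofReal ?_ ?_ fun x hx => ?_
    · exact ((differentiableOn_affineStieltjes hγ J₀ m).mono hsub).cpow_const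
        fun p hp => Or.inl (re_affineStieltjes_pos hγ hJ₀ hm hp)
    · exact (DifferentiableOn.mul (by fun_prop)
        ((differentiableOn_stieltjesT hσ0).mono hsub)).const_add _ |>.const_add _
    · have hQ : 0 ≤ J₀ + m * ∫ s, 1 / (x + s) ∂γ :=
        add_nonneg hJ₀.le (mul_nonneg hm (integral_one_div_add_nonneg hγ hx))
      rw [affineStieltjes_ofReal, ofReal_cpow_half hQ, hreal x hx, stieltjesT_ofReal]
      push_cast; rfl
  refine ⟨ν, ⟨?_, ?_, fun p hp => ?_⟩⟩
  · rw [← compl_Ioi]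
    exact ae_iff.1 hνpos
  · rw [hνr, hν, lintegral_withDensity_eq_lintegral_mul _ hwm (by fun_prop)]
    have : ∀ᵐ r ∂σ, (w * fun r => ENNReal.ofReal (1 / (1 + r))) r = ENNReal.ofReal (Real.sqrt ρ) := by
      filter_upwards [hσpos] with r hr
      rw [Pi.mul_apply, hw, ← ENNReal.ofReal_mul (by positivity)]
      congr 1
      field_simp
    rw [lintegral_congr_ae this, lintegral_const]
    exact ENNReal.mul_lt_top ENNReal.ofReal_lt_top (measure_lt_top _ _)
  · have h := hanal hp
    simp only at h
    rw [hκ p hp, h, hint p hp, div_eq_mul_inv, ← Complex.ofReal_inv, inv_wavefrontSpeed,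
      Real.sqrt_mul hρ.le]
    push_cast
    ring

/-! ### Total mass, attenuation function and relaxation kernel -/

theorem tendsto_mul_integral_one_div_add {γ : Measure ℝ} [IsProbabilityMeasure γ]
    (hγ : ∀ᵐ s ∂γ, 0 ≤ s) : Tendsto (fun x : ℝ => x * ∫ s, 1 / (x + s) ∂γ) atTop (𝓝 1) := by
  have h : Tendsto (fun x : ℝ => ∫ s, x * (1 / (x + s)) ∂γ) atTop (𝓝 (∫ _, (1 : ℝ) ∂γ)) := by
    refine tendsto_integral_filter_of_dominated_convergence (fun _ => 1)
      (Eventually.of_forall fun x => Measurable.aestronglyMeasurable (by fun_prop)) ?_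
      (integrable_const _) (Eventually.of_forall fun s => ?_)
    · filter_upwards [eventually_gt_atTop 0] with x hx
      filter_upwards [hγ] with s hs
      rw [mul_one_div, Real.norm_of_nonneg (by positivity)]
      exact (div_le_one (by linarith)).2 (by linarith)
    · have h1 : Tendsto (fun x : ℝ => 1 - s / (x + s)) atTop (𝓝 (1 - 0)) :=
        (tendsto_const_nhds.div_atTop (tendsto_atTop_add_const_right _ _ tendsto_id)).const_sub 1
      rw [sub_zero] at h1
      refine h1.congr' ?_
      filter_upwards [eventually_gt_atTop (-s)] with x hx
      have : x + s ≠ 0 := by linarith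
      field_simp
      ring
  simpa [integral_const_mul] using h

/-- Rationalize: the quantity is `m x S(x) / (√Q(x) + √J₀)`, and `x S(x) → 1`. -/
theorem tendsto_mul_sqrt_sub {γ : Measure ℝ} [IsProbabilityMeasure γ] (hγ : ∀ᵐ s ∂γ, 0 ≤ s)
    {J₀ m : ℝ} (hJ₀ : 0 < J₀) (hm : 0 ≤ m) :
    Tendsto (fun x : ℝ => x * (Real.sqrt (J₀ + m * ∫ s, 1 / (x + s) ∂γ) - Real.sqrt J₀)) atTop
      (𝓝 (m / (2 * Real.sqrt J₀))) := by
  have h1 := tendsto_mul_integral_one_div_add hγ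
  have h2 : Tendsto (fun x : ℝ => ∫ s, 1 / (x + s) ∂γ) atTop (𝓝 0) := by
    have := h1.mul tendsto_inv_atTop_zero
    rw [mul_zero] at this
    refine this.congr' ?_
    filter_upwards [eventually_gt_atTop 0] with x hx
    field_simp
  have hs : 0 < Real.sqrt J₀ := Real.sqrt_pos.2 hJ₀
  have h3 : Tendsto (fun x : ℝ => Real.sqrt (J₀ + m * ∫ s, 1 / (x + s) ∂γ)) atTop
      (𝓝 (Real.sqrt J₀)) := by
    have := (Real.continuous_sqrt.tendsto _).comp ((h2.const_mul m).const_add J₀)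
    simpa [Function.comp_def] using this
  have h4 := (h1.const_mul m).div (h3.add_const (Real.sqrt J₀)) (by positivity)
  rw [mul_one, ← two_mul] at h4
  refine h4.congr' ?_
  filter_upwards [eventually_gt_atTop 0] with x hx
  have hQ : 0 ≤ J₀ + m * ∫ s, 1 / (x + s) ∂γ :=
    add_nonneg hJ₀.le (mul_nonneg hm (integral_one_div_add_nonneg hγ hx))
  have h5 := Real.sq_sqrt hQ
  have h6 := Real.sq_sqrt hJ₀.le
  have h7 := Real.sqrt_nonneg (J₀ + m * ∫ s, 1 / (x + s) ∂γ)
  simp only [Pi.div_apply]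
  rw [div_eq_iff (by positivity)]
  linear_combination (-x) * h5 + x * h6

theorem IsAttenuationMeasure.integrableOn_one_div {κ : ℂ → ℂ} {c₀ : ℝ} {ν : Measure ℝ}
    (h : IsAttenuationMeasure κ c₀ ν) {x : ℝ} (hx : 1 ≤ x) :
    IntegrableOn (fun r : ℝ => 1 / (x + r)) (Ioi 0) ν := by
  have h1 : IntegrableOn (fun r : ℝ => 1 / (1 + r)) (Ioi 0) ν := by
    refine ⟨Measurable.aestronglyMeasurable (by fun_prop), ?_⟩
    rw [hasFiniteIntegral_iff_ofReal]
    · exact h.integrability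
    · filter_upwards [ae_restrict_mem measurableSet_Ioi] with r hr
      have hr : 0 < r := hr
      simp only [Pi.zero_apply]; positivity
  refine h1.integrable.mono' (Measurable.aestronglyMeasurable (by fun_prop)) ?_
  filter_upwards [ae_restrict_mem measurableSet_Ioi] with r hr
  have hr : 0 < r := hr
  rw [Real.norm_of_nonneg (by positivity)]
  exact one_div_le_one_div_of_le (by linarith) (by linarith)

/-- Monotone convergence for `x/(x+r) ↑ 1` identifies the limit of `x ∫ ν(dr)/(x+r)` with the mass,
without assuming it finite. The representation gives the same limit through `tendsto_mul_sqrt_sub`.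
No uniqueness of `ν` is needed. -/
theorem IsAttenuationMeasure.measure_Ioi {γ : Measure ℝ} [IsProbabilityMeasure γ]
    (hγ : ∀ᵐ s ∂γ, 0 ≤ s) {ρ J₀ m : ℝ} (hρ : 0 < ρ) (hJ₀ : 0 < J₀) (hm : 0 ≤ m) {κ : ℂ → ℂ}
    (hκ : ∀ p : ℂ, 0 < p.re →
      κ p = Real.sqrt ρ * p * (affineStieltjes γ J₀ m p) ^ (1 / 2 : ℂ)) {ν : Measure ℝ}
    (h : IsAttenuationMeasure κ (wavefrontSpeed ρ J₀) ν) :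
    ν (Ioi 0) = ENNReal.ofReal (m / (2 * wavefrontSpeed ρ J₀ * J₀)) := by
  -- Sampling at `x = n + 1` keeps `x ≥ 1`, where `1/(x+r)` is dominated by the integrable
  -- `1/(1+r)`.
  have hx1 : ∀ n : ℕ, (1 : ℝ) ≤ (n : ℝ) + 1 := fun n => by
    have : (0 : ℝ) ≤ n := n.cast_nonneg
    linarith
  have hI : ∀ x : ℝ, 0 < x → ∫ r in Ioi (0 : ℝ), 1 / (x + r) ∂ν
      = Real.sqrt ρ * (Real.sqrt (J₀ + m * ∫ s, 1 / (x + s) ∂γ) - Real.sqrt J₀) := by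
    intro x hx
    have hQ : 0 ≤ J₀ + m * ∫ s, 1 / (x + s) ∂γ :=
      add_nonneg hJ₀.le (mul_nonneg hm (integral_one_div_add_nonneg hγ hx))
    have e := h.representation x (by simpa using hx)
    rw [hκ x (by simpa using hx), affineStieltjes_ofReal, ofReal_cpow_half hQ, div_eq_mul_inv,
      ← Complex.ofReal_inv, inv_wavefrontSpeed, Real.sqrt_mul hρ.le] at e
    have e2 : ∫ r in Ioi (0 : ℝ), 1 / ((x : ℂ) + (r : ℂ)) ∂ν
        = ((∫ r in Ioi (0 : ℝ), 1 / (x + r) ∂ν : ℝ) : ℂ) := by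
      rw [← integral_complex_ofReal]; simp
    rw [e2] at e
    have e3 : Real.sqrt ρ * x * Real.sqrt (J₀ + m * ∫ s, 1 / (x + s) ∂γ)
        = x * (Real.sqrt ρ * Real.sqrt J₀) + x * ∫ r in Ioi (0 : ℝ), 1 / (x + r) ∂ν := by
      exact_mod_cast e
    refine mul_left_cancel₀ hx.ne' ?_
    linarith
  have hlim : Tendsto (fun n : ℕ => ENNReal.ofReal (((n : ℝ) + 1) *
      ∫ r in Ioi (0 : ℝ), 1 / ((n : ℝ) + 1 + r) ∂ν)) atTop
      (𝓝 (ENNReal.ofReal (m / (2 * wavefrontSpeed ρ J₀ * J₀)))) := by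
    refine ENNReal.tendsto_ofReal ?_
    have h1 := ((tendsto_mul_sqrt_sub hγ hJ₀ hm).const_mul (Real.sqrt ρ)).comp
      (tendsto_atTop_add_const_right atTop (1 : ℝ) (tendsto_natCast_atTop_atTop (R := ℝ)))
    have e : Real.sqrt ρ * (m / (2 * Real.sqrt J₀)) = m / (2 * wavefrontSpeed ρ J₀ * J₀) := by
      have h2 : 0 < Real.sqrt J₀ := Real.sqrt_pos.2 hJ₀
      have h3 : 0 < Real.sqrt ρ := Real.sqrt_pos.2 hρ
      rw [wavefrontSpeed, Real.sqrt_mul hρ.le]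
      nth_rewrite 3 [← Real.sq_sqrt hJ₀.le]
      field_simp
    rw [e] at h1
    refine h1.congr fun n => ?_
    simp only [Function.comp_apply]
    rw [hI _ (by linarith [hx1 n])]
    ring
  have hlint : ∀ n : ℕ, ENNReal.ofReal (((n : ℝ) + 1) *
      ∫ r in Ioi (0 : ℝ), 1 / ((n : ℝ) + 1 + r) ∂ν)
      = ∫⁻ r in Ioi (0 : ℝ), ENNReal.ofReal (((n : ℝ) + 1) * (1 / ((n : ℝ) + 1 + r))) ∂ν := by
    intro n
    rw [← integral_const_mul, ofReal_integral_eq_lintegral_ofReal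
      ((h.integrableOn_one_div (hx1 n)).integrable.const_mul _)]
    filter_upwards [ae_restrict_mem measurableSet_Ioi] with r hr
    have hr : 0 < r := hr
    simp only [Pi.zero_apply]; positivity
  have hmono : Tendsto (fun n : ℕ => ∫⁻ r in Ioi (0 : ℝ),
      ENNReal.ofReal (((n : ℝ) + 1) * (1 / ((n : ℝ) + 1 + r))) ∂ν) atTop
      (𝓝 (∫⁻ _ in Ioi (0 : ℝ), 1 ∂ν)) := by
    refine lintegral_tendsto_of_tendsto_of_monotone (fun n => by fun_prop) ?_ ?_
    · filter_upwards [ae_restrict_mem measurableSet_Ioi] with r hr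
      have hr : 0 < r := hr
      intro a b hab
      have hab' : (a : ℝ) ≤ b := by exact_mod_cast hab
      refine ENNReal.ofReal_le_ofReal ?_
      rw [mul_one_div, mul_one_div, div_le_div_iff₀ (by positivity) (by positivity)]
      nlinarith
    · filter_upwards [ae_restrict_mem measurableSet_Ioi] with r hr
      have hr : 0 < r := hr
      rw [← ENNReal.ofReal_one]
      refine ENNReal.tendsto_ofReal ?_
      have h1 : Tendsto (fun n : ℕ => 1 - r / ((n : ℝ) + 1 + r)) atTop (𝓝 (1 - 0)) :=
        (tendsto_const_nhds.div_atTop (tendsto_atTop_add_const_right _ _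
          (tendsto_atTop_add_const_right _ _ tendsto_natCast_atTop_atTop))).const_sub 1
      rw [sub_zero] at h1
      refine h1.congr fun n => ?_
      field_simp
      ring
  simp only [← hlint] at hmono
  rw [← tendsto_nhds_unique hmono hlim]
  simp

theorem tendsto_attenuation {ν : Measure ℝ} {N : ℝ} (hN : 0 ≤ N)
    (hν : ν (Ioi 0) = ENNReal.ofReal N) : Tendsto (attenuation ν) atTop (𝓝 N) := by
  have hfin : IsFiniteMeasure (ν.restrict (Ioi 0)) := ⟨by simp [hν]⟩
  have h : Tendsto (fun ω : ℝ => ∫ r in Ioi (0 : ℝ), ω ^ 2 * (1 / (r ^ 2 + ω ^ 2)) ∂ν) atTop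
      (𝓝 (∫ _ in Ioi (0 : ℝ), (1 : ℝ) ∂ν)) := by
    refine tendsto_integral_filter_of_dominated_convergence (fun _ => 1)
      (Eventually.of_forall fun x => Measurable.aestronglyMeasurable (by fun_prop)) ?_
      (integrable_const _) (Eventually.of_forall fun r => ?_)
    · refine Eventually.of_forall fun ω => Eventually.of_forall fun r => ?_
      rw [mul_one_div, Real.norm_of_nonneg (by positivity)]
      exact div_le_one_of_le₀ (by nlinarith [sq_nonneg r]) (by positivity)
    · have h1 : Tendsto (fun ω : ℝ => 1 - r ^ 2 / (r ^ 2 + ω ^ 2)) atTop (𝓝 (1 - 0)) :=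
        (tendsto_const_nhds.div_atTop (tendsto_atTop_add_const_left _ _
          (tendsto_pow_atTop two_ne_zero))).const_sub 1
      rw [sub_zero] at h1
      refine h1.congr' ?_
      filter_upwards [eventually_gt_atTop 0] with ω hω
      have : 0 < r ^ 2 + ω ^ 2 := by positivity
      field_simp
      ring
  simp only [integral_const_mul] at h
  have e : ∫ _ in Ioi (0 : ℝ), (1 : ℝ) ∂ν = N := by
    simp [measureReal_def, hν, hN]
  rw [e] at h
  exact h

theorem attenuation_mem_Icc {ν : Measure ℝ} {N : ℝ} (hN : 0 ≤ N)
    (hν : ν (Ioi 0) = ENNReal.ofReal N) (ω : ℝ) : 0 ≤ attenuation ν ω ∧ attenuation ν ω ≤ N := by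
  have hfin : IsFiniteMeasure (ν.restrict (Ioi 0)) := ⟨by simp [hν]⟩
  have e : ∫ _ in Ioi (0 : ℝ), (1 : ℝ) ∂ν = N := by
    simp [measureReal_def, hν, hN]
  rw [attenuation, ← integral_const_mul]
  refine ⟨integral_nonneg fun r => by positivity, ?_⟩
  rw [← e]
  refine integral_mono_of_nonneg (Eventually.of_forall fun r => by positivity)
    (integrable_const _) (Eventually.of_forall fun r => ?_)
  simp only
  rw [mul_one_div]
  exact div_le_one_of_le₀ (by nlinarith [sq_nonneg r]) (by positivity)

theorem tendsto_relaxationKernel {ν : Measure ℝ} {N : ℝ} (hN : 0 ≤ N)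
    (hν : ν (Ioi 0) = ENNReal.ofReal N) : Tendsto (relaxationKernel ν) (𝓝[>] 0) (𝓝 N) := by
  have hfin : IsFiniteMeasure (ν.restrict (Ioi 0)) := ⟨by simp [hν]⟩
  have e : ∫ _ in Ioi (0 : ℝ), (1 : ℝ) ∂ν = N := by
    simp [measureReal_def, hν, hN]
  rw [← e]
  refine tendsto_integral_filter_of_dominated_convergence (fun _ => 1)
    (Eventually.of_forall fun x => Measurable.aestronglyMeasurable (by fun_prop)) ?_
    (integrable_const _) (Eventually.of_forall fun r => ?_)
  · filter_upwards [self_mem_nhdsWithin] with t ht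
    filter_upwards [ae_restrict_mem measurableSet_Ioi] with r hr
    have hr : 0 < r := hr
    have ht : 0 < t := ht
    rw [Real.norm_of_nonneg (Real.exp_nonneg _)]
    exact Real.exp_le_one_iff.2 (by nlinarith)
  · have hc : Continuous fun t : ℝ => Real.exp (-r * t) := by fun_prop
    simpa using (hc.tendsto 0).mono_left (nhdsWithin_le_nhds (s := Ioi 0))

/-! ### Integrals along vertical lines -/

theorem vertical_integral_sub {f : ℂ → ℂ} {a b R : ℝ}
    (hf : DifferentiableOn ℂ f {z | z.re ∈ uIcc a b}) :
    Complex.I * ((∫ y in (-R)..R, f (b + y * Complex.I)) - ∫ y in (-R)..R, f (a + y * Complex.I))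
      = (∫ x in a..b, f (x + (R : ℂ) * Complex.I)) - ∫ x in a..b, f (x + (-R : ℝ) * Complex.I) := by
  have h := Complex.integral_boundary_rect_eq_zero_of_differentiableOn f ⟨a, -R⟩ ⟨b, R⟩
    (hf.mono fun z hz => hz.1)
  simp only [smul_eq_mul] at h
  linear_combination h

theorem norm_vertical_integral_sub_le {f : ℂ → ℂ} {a b R H : ℝ}
    (hf : DifferentiableOn ℂ f {z | z.re ∈ uIcc a b})
    (h1 : ‖∫ x in a..b, f (x + (R : ℂ) * Complex.I)‖ ≤ H)
    (h2 : ‖∫ x in a..b, f (x + (-R : ℝ) * Complex.I)‖ ≤ H) :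
    ‖(∫ y in (-R)..R, f (b + y * Complex.I)) - ∫ y in (-R)..R, f (a + y * Complex.I)‖ ≤ 2 * H := by
  have h := congrArg norm (vertical_integral_sub (R := R) hf)
  rw [norm_mul, Complex.norm_I, one_mul] at h
  rw [h]
  refine (norm_sub_le _ _).trans ?_
  linarith

theorem abs_le_norm_add_mul_I (x y : ℝ) : |y| ≤ ‖(x : ℂ) + y * Complex.I‖ := by
  simpa using Complex.abs_im_le_norm ((x : ℂ) + y * Complex.I)

/-- Cauchy's theorem on a rectangle: the horizontal sides have fixed length and an integrand of size
`O(1/R)`. -/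
theorem tendsto_vertical_integral_sub {f : ℂ → ℂ} {a b K : ℝ}
    (hf : DifferentiableOn ℂ f {z | z.re ∈ uIcc a b})
    (hK : ∀ x ∈ uIcc a b, ∀ y : ℝ, y ≠ 0 → ‖f (x + y * Complex.I)‖ ≤ K / |y|) :
    Tendsto (fun R : ℝ => (∫ y in (-R)..R, f (b + y * Complex.I)) -
      ∫ y in (-R)..R, f (a + y * Complex.I)) atTop (𝓝 0) := by
  refine squeeze_zero_norm' (a := fun R : ℝ => 2 * (K / R * |b - a|)) ?_ ?_
  · filter_upwards [eventually_gt_atTop 0] with R hR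
    refine norm_vertical_integral_sub_le hf ?_ ?_
    · refine intervalIntegral.norm_integral_le_of_norm_le_const fun x hx => ?_
      have := hK x (uIoc_subset_uIcc hx) R hR.ne'
      rwa [abs_of_pos hR] at this
    · refine intervalIntegral.norm_integral_le_of_norm_le_const fun x hx => ?_
      have := hK x (uIoc_subset_uIcc hx) (-R) (by linarith)
      rwa [abs_neg, abs_of_pos hR] at this
  · have : Tendsto (fun R : ℝ => K / R) atTop (𝓝 0) := tendsto_const_nhds.div_atTop tendsto_id
    simpa using (this.mul_const |b - a|).const_mul 2

theorem tendsto_vertical_integral_sub_of_pos {f : ℂ → ℂ} {ε K T : ℝ} (hε : 0 < ε)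
    (hf : DifferentiableOn ℂ f {z | 0 < z.re})
    (hK : ∀ p : ℂ, ε ≤ p.re → ‖f p‖ ≤ K * Real.exp (T * p.re) / ‖p‖) {a b : ℝ} (ha : ε ≤ a)
    (hb : ε ≤ b) :
    Tendsto (fun R : ℝ => (∫ y in (-R)..R, f (b + y * Complex.I)) -
      ∫ y in (-R)..R, f (a + y * Complex.I)) atTop (𝓝 0) := by
  have hle : ∀ x ∈ uIcc a b, ε ≤ x := fun x hx => (le_inf ha hb).trans hx.1
  refine tendsto_vertical_integral_sub (K := |K| * Real.exp (|T| * (a ⊔ b)))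
    (hf.mono fun z hz => hε.trans_le (hle _ hz)) fun x hx y hy => ?_
  have h1 := hK (x + y * Complex.I) (by simpa using hle x hx)
  have hx0 : 0 < x := hε.trans_le (hle x hx)
  have h2 : K * Real.exp (T * (x + y * Complex.I : ℂ).re) ≤ |K| * Real.exp (|T| * (a ⊔ b)) := by
    have : (x + y * Complex.I : ℂ).re = x := by simp
    rw [this]
    have h3 : T * x ≤ |T| * (a ⊔ b) :=
      mul_le_mul (le_abs_self T) hx.2 hx0.le (abs_nonneg T)
    exact mul_le_mul (le_abs_self K) (Real.exp_le_exp.2 h3) (Real.exp_nonneg _) (abs_nonneg _)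
  refine h1.trans ?_
  exact div_le_div₀ (by positivity) h2 (abs_pos.2 hy) (abs_le_norm_add_mul_I x y)

/-- Push the right side of the rectangle to infinity at fixed height: for `T < 0` it disappears, and
each horizontal side is at most `K/R` times the integral of `e^{Tx}` over `[a,∞[`. -/
theorem norm_vertical_integral_le_of_neg {f : ℂ → ℂ} {a K T R : ℝ} (ha : 0 < a) (hT : T < 0)
    (hK0 : 0 ≤ K) (hf : DifferentiableOn ℂ f {z | 0 < z.re})
    (hK : ∀ p : ℂ, a ≤ p.re → ‖f p‖ ≤ K * Real.exp (T * p.re) / ‖p‖) (hR : 0 < R) :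
    ‖∫ y in (-R)..R, f (a + y * Complex.I)‖ ≤ 2 * (K / R * (Real.exp (T * a) / -T)) := by
  have hhor : ∀ b, a ≤ b → ∀ y : ℝ, |y| = R →
      ‖∫ x in a..b, f (x + (y : ℂ) * Complex.I)‖ ≤ K / R * (Real.exp (T * a) / -T) := by
    intro b hab y hy
    have h1 : ‖∫ x in a..b, f (x + (y : ℂ) * Complex.I)‖
        ≤ ∫ x in a..b, K / R * Real.exp (T * x) := by
      refine intervalIntegral.norm_integral_le_of_norm_le hab
        (Eventually.of_forall fun x hx => ?_) ((by fun_prop : Continuous _).intervalIntegrable _ _)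
      refine (hK _ (by simpa using hx.1.le)).trans ?_
      have h2 := abs_le_norm_add_mul_I x y
      rw [hy] at h2
      have h3 : ((x : ℂ) + y * Complex.I).re = x := by simp
      rw [h3, div_mul_eq_mul_div]
      gcongr
    refine h1.trans ?_
    have h4 : ∫ x in a..b, K / R * Real.exp (T * x)
        = K / R * ((Real.exp (T * b) - Real.exp (T * a)) / T) := by
      rw [intervalIntegral.integral_const_mul]
      congr 1
      have : ∀ x ∈ uIcc a b, HasDerivAt (fun x => Real.exp (T * x) / T) (Real.exp (T * x)) x := by
        intro x _
        have := (((hasDerivAt_id' x).const_mul T).exp).div_const T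
        simpa [hT.ne] using this
      rw [intervalIntegral.integral_eq_sub_of_hasDerivAt this
        ((by fun_prop : Continuous _).intervalIntegrable _ _)]
      ring
    rw [h4]
    refine mul_le_mul_of_nonneg_left ?_ (by positivity)
    rw [← neg_div_neg_eq (Real.exp (T * b) - _), neg_sub]
    exact div_le_div_of_nonneg_right (by linarith [Real.exp_nonneg (T * b)]) (by linarith)
  have hlim : Tendsto (fun b : ℝ => ‖∫ y in (-R)..R, f (b + y * Complex.I)‖ +
      2 * (K / R * (Real.exp (T * a) / -T))) atTop
      (𝓝 (0 + 2 * (K / R * (Real.exp (T * a) / -T)))) := by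
    refine Tendsto.add_const _ ?_
    refine squeeze_zero' (g := fun b => K * Real.exp (T * b) / a * |R - -R|)
      (Eventually.of_forall fun b => norm_nonneg _) ?_ ?_
    · filter_upwards [eventually_ge_atTop a] with b hb
      refine intervalIntegral.norm_integral_le_of_norm_le_const fun y _ => ?_
      have h3 : ((b : ℂ) + y * Complex.I).re = b := by simp
      refine (hK _ (by rwa [h3])).trans ?_
      have h5 : a ≤ ‖(b : ℂ) + y * Complex.I‖ := by
        refine hb.trans ?_
        have := Complex.re_le_norm ((b : ℂ) + y * Complex.I)
        rwa [h3] at this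
      rw [h3]
      gcongr
    · have : Tendsto (fun b : ℝ => Real.exp (T * b)) atTop (𝓝 0) :=
        Real.tendsto_exp_atBot.comp (tendsto_id.const_mul_atTop_of_neg hT)
      simpa using ((this.const_mul K).div_const a).mul_const |R - -R|
  rw [zero_add] at hlim
  refine ge_of_tendsto hlim ?_
  filter_upwards [eventually_ge_atTop a] with b hb
  have hd : DifferentiableOn ℂ f {z | z.re ∈ uIcc a b} := hf.mono fun z hz => by
    rw [uIcc_of_le hb] at hz
    exact ha.trans_le hz.1
  have h6 := norm_vertical_integral_sub_le hd (hhor b hb R (abs_of_pos hR))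
    (hhor b hb (-R) (by rw [abs_neg, abs_of_pos hR]))
  rw [norm_sub_rev] at h6
  have h7 := norm_sub_norm_le (∫ y in (-R)..R, f (a + y * Complex.I))
    (∫ y in (-R)..R, f (b + y * Complex.I))
  linarith

theorem tendsto_vertical_integral_of_neg {f : ℂ → ℂ} {a K T : ℝ} (ha : 0 < a) (hT : T < 0)
    (hf : DifferentiableOn ℂ f {z | 0 < z.re})
    (hK : ∀ p : ℂ, a ≤ p.re → ‖f p‖ ≤ K * Real.exp (T * p.re) / ‖p‖) :
    Tendsto (fun R : ℝ => ∫ y in (-R)..R, f (a + y * Complex.I)) atTop (𝓝 0) := by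
  have hK' : ∀ p : ℂ, a ≤ p.re → ‖f p‖ ≤ |K| * Real.exp (T * p.re) / ‖p‖ := fun p hp =>
    (hK p hp).trans (by gcongr; exact le_abs_self K)
  refine squeeze_zero_norm' (a := fun R : ℝ => 2 * (|K| / R * (Real.exp (T * a) / -T))) ?_ ?_
  · filter_upwards [eventually_gt_atTop 0] with R hR
    exact norm_vertical_integral_le_of_neg ha hT (abs_nonneg K) hf hK' hR
  · have : Tendsto (fun R : ℝ => |K| / R) atTop (𝓝 0) := tendsto_const_nhds.div_atTop tendsto_id
    simpa using (this.mul_const (Real.exp (T * a) / -T)).const_mul 2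

theorem vertical_line_ne_zero {a : ℝ} (ha : a ≠ 0) (y : ℝ) : (a : ℂ) + y * Complex.I ≠ 0 := by
  intro h
  have := congrArg Complex.re h
  simp at this
  exact ha this

theorem intervalIntegral_eq_ofReal_of_conj {f : ℝ → ℂ} (hf : Continuous f)
    (hc : ∀ y, f (-y) = (starRingEnd ℂ) (f y)) (R : ℝ) :
    ∫ y in (-R)..R, f y = ((∫ y in (-R)..R, (f y).re : ℝ) : ℂ) := by
  have h1 : (starRingEnd ℂ) (∫ y in (-R)..R, f y) = ∫ y in (-R)..R, f y := by
    rw [← intervalIntegral.intervalIntegral_conj]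
    simp only [← hc]
    rw [intervalIntegral.integral_comp_neg, neg_neg]
  have h2 : (∫ y in (-R)..R, f y).re = ∫ y in (-R)..R, (f y).re := by
    have := Complex.reCLM.intervalIntegral_comp_comm (hf.intervalIntegrable (-R) R (μ := volume))
    simpa using this.symm
  rw [← h2]
  exact (Complex.conj_eq_iff_re.1 h1).symm

theorem tendsto_vertical_integral_inv {a : ℝ} (ha : 0 < a) :
    Tendsto (fun R : ℝ => ∫ y in (-R)..R, 1 / ((a : ℂ) + y * Complex.I)) atTop (𝓝 Real.pi) := by
  have hc : Continuous fun y : ℝ => 1 / ((a : ℂ) + y * Complex.I) :=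
    Continuous.div (by fun_prop) (by fun_prop) (vertical_line_ne_zero ha.ne')
  have e : ∀ R : ℝ, ∫ y in (-R)..R, 1 / ((a : ℂ) + y * Complex.I)
      = ((2 * Real.arctan (R / a) : ℝ) : ℂ) := by
    intro R
    rw [intervalIntegral_eq_ofReal_of_conj hc (fun y => by simp)]
    congr 1
    have hd : ∀ y ∈ uIcc (-R) R, HasDerivAt (fun y => Real.arctan (y / a))
        ((1 / ((a : ℂ) + y * Complex.I)).re) y := by
      intro y _
      refine (((hasDerivAt_id' y).div_const a).arctan).congr_deriv ?_
      simp only [one_div]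
      rw [Complex.inv_re, Complex.normSq_apply]
      simp
      have : 0 < a * a + y * y := by nlinarith [mul_pos ha ha, mul_self_nonneg y]
      field_simp
    rw [intervalIntegral.integral_eq_sub_of_hasDerivAt hd
      ((Complex.continuous_re.comp hc).intervalIntegrable _ _), neg_div, Real.arctan_neg]
    ring
  simp only [e]
  refine (Complex.continuous_ofReal.tendsto _).comp ?_
  have h1 : Tendsto (fun R : ℝ => Real.arctan (R / a)) atTop (𝓝 (Real.pi / 2)) :=
    (Real.tendsto_arctan_atTop.mono_right nhdsWithin_le_nhds).comp (tendsto_id.atTop_div_const ha)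
  have := h1.const_mul 2
  rwa [mul_div_cancel₀ _ two_ne_zero] at this

theorem norm_cexp_mul_ofReal (p : ℂ) (T : ℝ) : ‖Complex.exp (p * T)‖ = Real.exp (T * p.re) := by
  rw [Complex.norm_exp, Complex.re_mul_ofReal, mul_comm]

theorem tendsto_vertical_integral_exp_div_of_neg {a T : ℝ} (ha : 0 < a) (hT : T < 0) :
    Tendsto (fun R : ℝ => ∫ y in (-R)..R, Complex.exp (((a : ℂ) + y * Complex.I) * T) /
      ((a : ℂ) + y * Complex.I)) atTop (𝓝 0) := by
  refine tendsto_vertical_integral_of_neg (f := fun p => Complex.exp (p * T) / p) (K := 1) ha hT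
    (DifferentiableOn.div (by fun_prop) (by fun_prop) fun z hz => ?_) fun p _ => ?_
  · rintro rfl
    simp at hz
  · rw [norm_div, norm_cexp_mul_ofReal, one_mul]

/-- A residue computation without residues: `E(p) = (e^{pT} - 1)/p` is entire, so its line integral
may be moved from `a` to `-a`. Reflecting `p ↦ -p` there turns `T` into `-T`, whose integral
vanishes in the limit; the two integrals of `1/p` give `π` each. -/
theorem tendsto_vertical_integral_exp_div_of_pos {a T : ℝ} (ha : 0 < a) (hT : 0 < T) :
    Tendsto (fun R : ℝ => ∫ y in (-R)..R, Complex.exp (((a : ℂ) + y * Complex.I) * T) /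
      ((a : ℂ) + y * Complex.I)) atTop (𝓝 (2 * Real.pi)) := by
  set E : ℂ → ℂ := dslope (fun p => Complex.exp (p * T)) 0 with hE
  have hEd : Differentiable ℂ E := by
    rw [← differentiableOn_univ, hE, Complex.differentiableOn_dslope Filter.univ_mem]
    fun_prop
  have hEne : ∀ p : ℂ, p ≠ 0 → E p = Complex.exp (p * T) / p - 1 / p := by
    intro p hp
    rw [hE, dslope_of_ne _ hp, slope_def_field]
    simp [sub_div]
  have hcont : ∀ b : ℝ, b ≠ 0 → ∀ S : ℝ, Continuous fun y : ℝ =>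
      Complex.exp (((b : ℂ) + y * Complex.I) * S) / ((b : ℂ) + y * Complex.I) := fun b hb S =>
    Continuous.div (by fun_prop) (by fun_prop) (vertical_line_ne_zero hb)
  have hcont1 : ∀ b : ℝ, b ≠ 0 → Continuous fun y : ℝ => 1 / ((b : ℂ) + y * Complex.I) :=
    fun b hb => Continuous.div (by fun_prop) (by fun_prop) (vertical_line_ne_zero hb)
  have hsplit : ∀ b : ℝ, b ≠ 0 → ∀ R : ℝ, ∫ y in (-R)..R, E (b + y * Complex.I)
      = (∫ y in (-R)..R, Complex.exp (((b : ℂ) + y * Complex.I) * T) / ((b : ℂ) + y * Complex.I))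
        - ∫ y in (-R)..R, 1 / ((b : ℂ) + y * Complex.I) := by
    intro b hb R
    rw [← intervalIntegral.integral_sub ((hcont b hb T).intervalIntegrable _ _)
      ((hcont1 b hb).intervalIntegrable _ _)]
    exact intervalIntegral.integral_congr fun y _ => hEne _ (vertical_line_ne_zero hb y)
  have hneg : ∀ R : ℝ, ∫ y in (-R)..R, E ((-a : ℝ) + y * Complex.I)
      = (∫ y in (-R)..R, 1 / ((a : ℂ) + y * Complex.I)) -
        ∫ y in (-R)..R, Complex.exp (((a : ℂ) + y * Complex.I) * (-T : ℝ)) /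
          ((a : ℂ) + y * Complex.I) := by
    intro R
    have := intervalIntegral.integral_comp_neg (a := -R) (b := R)
      fun y : ℝ => E ((-a : ℝ) + y * Complex.I)
    rw [neg_neg] at this
    rw [← this, ← intervalIntegral.integral_sub ((hcont1 a ha.ne').intervalIntegrable _ _)
      ((hcont a ha.ne' (-T)).intervalIntegrable _ _)]
    refine intervalIntegral.integral_congr fun y _ => ?_
    have h0 := vertical_line_ne_zero ha.ne' y
    have e : (((-a : ℝ) : ℂ) + ((-y : ℝ) : ℂ) * Complex.I) = -((a : ℂ) + y * Complex.I) := by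
      push_cast; ring
    rw [e, hEne _ (neg_ne_zero.2 h0)]
    push_cast
    rw [div_neg, div_neg, neg_mul, mul_neg]
    ring
  have h1 := tendsto_vertical_integral_sub (f := E) (a := -a) (b := a)
    (K := Real.exp (T * a) + 1) hEd.differentiableOn fun x hx y hy => by
      rw [uIcc_of_le (by linarith)] at hx
      have hne : (x : ℂ) + y * Complex.I ≠ 0 := by
        intro h
        have := congrArg Complex.im h
        simp at this
        exact hy this
      rw [hEne _ hne, ← sub_div, norm_div]
      refine div_le_div₀ (by positivity) ((norm_sub_le _ _).trans ?_) (abs_pos.2 hy)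
        (abs_le_norm_add_mul_I x y)
      rw [norm_cexp_mul_ofReal, norm_one]
      have : ((x : ℂ) + y * Complex.I).re = x := by simp
      rw [this]
      have := Real.exp_le_exp.2 (mul_le_mul_of_nonneg_left hx.2 hT.le)
      linarith
  have h2 := tendsto_vertical_integral_inv ha
  have h3 := tendsto_vertical_integral_exp_div_of_neg ha (neg_lt_zero.2 hT)
  have h4 := (h1.add (h2.add h2)).sub h3
  have e : (0 + ((Real.pi : ℂ) + Real.pi) - 0) = 2 * Real.pi := by ring
  rw [e] at h4
  refine h4.congr fun R => ?_
  rw [hneg R, hsplit a ha.ne' R]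
  ring

theorem exists_tendsto_vertical_integral_exp_div {a : ℝ} (ha : 0 < a) (T : ℝ) :
    ∃ c : ℂ, Tendsto (fun R : ℝ => ∫ y in (-R)..R, Complex.exp (((a : ℂ) + y * Complex.I) * T) /
      ((a : ℂ) + y * Complex.I)) atTop (𝓝 c) := by
  rcases lt_trichotomy T 0 with h | rfl | h
  · exact ⟨_, tendsto_vertical_integral_exp_div_of_neg ha h⟩
  · refine ⟨Real.pi, ?_⟩
    simpa using tendsto_vertical_integral_inv ha
  · exact ⟨_, tendsto_vertical_integral_exp_div_of_pos ha h⟩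

/-! ### Laplace inversion near the front -/

/-- Decay of order `1/p²` gives absolute convergence, hence continuity in `T`. The inverse transform
vanishes for `T < 0`, so it vanishes at `0`, and its right limit there is `0`. -/
theorem exists_inverse_laplace_remainder {Ψ : ℂ → ℂ} {a K : ℝ} (ha : 0 < a)
    (hΨ : DifferentiableOn ℂ Ψ {z | 0 < z.re})
    (hK : ∀ p : ℂ, a ≤ p.re → ‖Ψ p‖ ≤ K / ‖p‖ ^ 2) :
    ∃ W : ℝ → ℂ, (∀ T : ℝ, Tendsto (fun R : ℝ => ∫ y in (-R)..R,
      Complex.exp (((a : ℂ) + y * Complex.I) * T) * Ψ (a + y * Complex.I)) atTop (𝓝 (W T))) ∧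
      Tendsto W (𝓝[>] 0) (𝓝 0) := by
  have hK0 : 0 ≤ K := by
    have h := (norm_nonneg _).trans (hK a (by simp))
    rw [Complex.norm_real, Real.norm_of_nonneg ha.le] at h
    by_contra! h'
    exact absurd h (not_le.2 (div_neg_of_neg_of_pos h' (by positivity)))
  have hre : ∀ y : ℝ, ((a : ℂ) + y * Complex.I).re = a := fun y => by simp
  have hΨc : Continuous fun y : ℝ => Ψ (a + y * Complex.I) :=
    hΨ.continuousOn.comp_continuous (by fun_prop) fun y => by
      change 0 < ((a : ℂ) + y * Complex.I).re
      rwa [hre]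
  -- The factor `1 + 1/a²` is what compares `1/(a²+y²)` with `1/(1+y²)`.
  set B : ℝ → ℝ := fun y => K * (1 + 1 / a ^ 2) * (1 + y ^ 2)⁻¹ with hB
  have hBi : Integrable B := integrable_inv_one_add_sq.const_mul _
  have hbound : ∀ y : ℝ, ‖Ψ (a + y * Complex.I)‖ ≤ B y := by
    intro y
    refine (hK _ (hre y).ge).trans ?_
    have e : ‖(a : ℂ) + y * Complex.I‖ ^ 2 = a ^ 2 + y ^ 2 := by
      rw [Complex.sq_norm, Complex.normSq_add_mul_I]
    rw [e]
    simp only [hB]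
    rw [← div_eq_mul_inv, div_le_div_iff₀ (by positivity) (by positivity), mul_assoc]
    refine mul_le_mul_of_nonneg_left ?_ hK0
    have : (1 + 1 / a ^ 2) * (a ^ 2 + y ^ 2) = 1 + y ^ 2 + (a ^ 2 + y ^ 2 / a ^ 2) := by
      field_simp; ring
    rw [this]
    have : 0 ≤ a ^ 2 + y ^ 2 / a ^ 2 := by positivity
    linarith
  set V : ℝ → ℂ := fun T => ∫ y : ℝ, Complex.exp (y * T * Complex.I) * Ψ (a + y * Complex.I) with hV
  have hnorm : ∀ y T : ℝ, ‖Complex.exp (y * T * Complex.I) * Ψ (a + y * Complex.I)‖ ≤ B y := by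
    intro y T
    rw [norm_mul, ← Complex.ofReal_mul, Complex.norm_exp_ofReal_mul_I, one_mul]
    exact hbound y
  have hVc : Continuous V := by
    refine continuous_of_dominated (bound := B) (fun T => ?_)
      (fun T => Eventually.of_forall fun y => hnorm y T) hBi (Eventually.of_forall fun y => by fun_prop)
    exact (Continuous.mul (by fun_prop) hΨc).aestronglyMeasurable
  have hlim : ∀ T : ℝ, Tendsto (fun R : ℝ => ∫ y in (-R)..R,
      Complex.exp (((a : ℂ) + y * Complex.I) * T) * Ψ (a + y * Complex.I)) atTop
      (𝓝 (Complex.exp (a * T) * V T)) := by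
    intro T
    have hi : Integrable fun y : ℝ => Complex.exp (y * T * Complex.I) * Ψ (a + y * Complex.I) :=
      hBi.mono' (Continuous.mul (by fun_prop) hΨc).aestronglyMeasurable
        (Eventually.of_forall fun y => hnorm y T)
    refine ((intervalIntegral_tendsto_integral hi tendsto_neg_atTop_atBot tendsto_id).const_mul
      (Complex.exp (a * T))).congr fun R => ?_
    rw [← intervalIntegral.integral_const_mul]
    refine intervalIntegral.integral_congr fun y _ => ?_
    rw [← mul_assoc, ← Complex.exp_add]
    congr 2; ring
  refine ⟨fun T => Complex.exp (a * T) * V T, hlim, ?_⟩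
  have hVneg : ∀ T : ℝ, T < 0 → V T = 0 := by
    intro T hT
    have h0 := tendsto_vertical_integral_of_neg (f := fun p => Complex.exp (p * T) * Ψ p)
      (K := K / a) ha hT (DifferentiableOn.mul (by fun_prop) hΨ) fun p hp => by
        have hpn : a ≤ ‖p‖ := hp.trans (Complex.re_le_norm p)
        have hp0 : 0 < ‖p‖ := ha.trans_le hpn
        rw [norm_mul, norm_cexp_mul_ofReal]
        calc Real.exp (T * p.re) * ‖Ψ p‖ ≤ Real.exp (T * p.re) * (K / ‖p‖ ^ 2) := by
              gcongr; exact hK p hp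
          _ = K / ‖p‖ * Real.exp (T * p.re) / ‖p‖ := by field_simp
          _ ≤ K / a * Real.exp (T * p.re) / ‖p‖ := by gcongr
    have := tendsto_nhds_unique (hlim T) h0
    exact (mul_eq_zero.1 this).resolve_left (Complex.exp_ne_zero _)
  have hV0 : V 0 = 0 := by
    have h1 : Tendsto V (𝓝[<] 0) (𝓝 (V 0)) := (hVc.tendsto 0).mono_left nhdsWithin_le_nhds
    have h2 : Tendsto V (𝓝[<] 0) (𝓝 0) := by
      refine tendsto_const_nhds.congr' ?_
      filter_upwards [self_mem_nhdsWithin] with T hT using (hVneg T hT).symm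
    exact tendsto_nhds_unique h1 h2
  have hWc : Continuous fun T : ℝ => Complex.exp (a * T) * V T := by fun_prop
  have := (hWc.tendsto 0).mono_left (nhdsWithin_le_nhds (s := Ioi 0))
  simpa [hV0] using this

/-- Inversion of a Laplace transform with leading term `C / p`. -/
theorem exists_inverse_laplace {Φ : ℂ → ℂ} {C : ℝ} (hΦ : DifferentiableOn ℂ Φ {z | 0 < z.re})
    (hconj : ∀ p : ℂ, 0 < p.re → Φ ((starRingEnd ℂ) p) = (starRingEnd ℂ) (Φ p))
    (hK : ∀ a : ℝ, 0 < a → ∃ K, ∀ p : ℂ, a ≤ p.re → ‖Φ p - C / p‖ ≤ K / ‖p‖ ^ 2) :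
    ∃ U : ℝ → ℝ, (∀ ε : ℝ, 0 < ε → ∀ T : ℝ, Tendsto (fun R : ℝ => (1 / (2 * Real.pi) : ℂ) *
      ∫ y in (-R)..R, Complex.exp (((ε : ℂ) + y * Complex.I) * T) * Φ (ε + y * Complex.I)) atTop
        (𝓝 (U T : ℂ))) ∧ (∀ T : ℝ, T < 0 → U T = 0) ∧ Tendsto U (𝓝[>] 0) (𝓝 C) := by
  have hre : ∀ a y : ℝ, ((a : ℂ) + y * Complex.I).re = a := fun a y => by simp
  have hbound : ∀ a : ℝ, 0 < a → ∀ T : ℝ, ∃ K, ∀ p : ℂ, a ≤ p.re →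
      ‖Complex.exp (p * T) * Φ p‖ ≤ K * Real.exp (T * p.re) / ‖p‖ := by
    intro a ha T
    obtain ⟨K, hK⟩ := hK a ha
    refine ⟨|C| + |K| / a, fun p hp => ?_⟩
    have hpn : a ≤ ‖p‖ := hp.trans (Complex.re_le_norm p)
    have hp0 : 0 < ‖p‖ := ha.trans_le hpn
    have h1 : ‖Φ p‖ ≤ (|C| + |K| / a) / ‖p‖ := by
      calc ‖Φ p‖ = ‖C / p + (Φ p - C / p)‖ := by ring_nf
        _ ≤ ‖(C : ℂ) / p‖ + ‖Φ p - C / p‖ := norm_add_le _ _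
        _ ≤ |C| / ‖p‖ + |K| / ‖p‖ ^ 2 := by
            rw [norm_div, Complex.norm_real, Real.norm_eq_abs]
            gcongr
            exact (hK p hp).trans (by gcongr; exact le_abs_self K)
        _ = (|C| + |K| / ‖p‖) / ‖p‖ := by field_simp
        _ ≤ _ := by gcongr
    rw [norm_mul, norm_cexp_mul_ofReal]
    calc Real.exp (T * p.re) * ‖Φ p‖ ≤ Real.exp (T * p.re) * ((|C| + |K| / a) / ‖p‖) := by gcongr
      _ = _ := by ring
  have hd : ∀ T : ℝ, DifferentiableOn ℂ (fun p => Complex.exp (p * T) * Φ p) {z | 0 < z.re} :=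
    fun T => DifferentiableOn.mul (by fun_prop) hΦ
  -- It suffices to find the limit on `Re p = 1`; contour shifting transfers it to every other line.
  have hindep : ∀ T ε : ℝ, 0 < ε → ∀ v : ℂ, Tendsto (fun R : ℝ => ∫ y in (-R)..R,
      Complex.exp (((1 : ℝ) + y * Complex.I) * T) * Φ ((1 : ℝ) + y * Complex.I)) atTop (𝓝 v) →
      Tendsto (fun R : ℝ => ∫ y in (-R)..R,
        Complex.exp (((ε : ℂ) + y * Complex.I) * T) * Φ (ε + y * Complex.I)) atTop (𝓝 v) := by
    intro T ε hε v hv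
    have hm : 0 < min ε 1 := lt_min hε one_pos
    obtain ⟨K, hK⟩ := hbound _ hm T
    have h := tendsto_vertical_integral_sub_of_pos hm (hd T) hK (min_le_right ε 1)
      (min_le_left ε 1)
    have h2 := h.add hv
    rw [zero_add] at h2
    refine h2.congr fun R => ?_
    simp only [sub_add_cancel]
  have hcont : ∀ T : ℝ, Continuous fun y : ℝ =>
      Complex.exp (((1 : ℝ) + y * Complex.I) * T) * Φ ((1 : ℝ) + y * Complex.I) := fun T =>
    (hd T).continuousOn.comp_continuous (by fun_prop) fun y => by
      change 0 < (((1 : ℝ) : ℂ) + y * Complex.I).re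
      rw [hre]; exact one_pos
  obtain ⟨K, hK1⟩ := hK 1 one_pos
  have hp0 : ∀ p : ℂ, p ∈ {z : ℂ | 0 < z.re} → p ≠ 0 := by
    rintro p hp rfl
    simp at hp
  have hΨd : DifferentiableOn ℂ (fun p => Φ p - C / p) {z | 0 < z.re} :=
    hΦ.sub (DifferentiableOn.div (by fun_prop) (by fun_prop) hp0)
  obtain ⟨W, hW, hW0⟩ := exists_inverse_laplace_remainder one_pos hΨd hK1
  have hlim : ∀ (T : ℝ) (c : ℂ), Tendsto (fun R : ℝ => ∫ y in (-R)..R,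
      Complex.exp ((((1 : ℝ) : ℂ) + y * Complex.I) * T) / (((1 : ℝ) : ℂ) + y * Complex.I)) atTop (𝓝 c) →
      Tendsto (fun R : ℝ => ∫ y in (-R)..R,
        Complex.exp (((1 : ℝ) + y * Complex.I) * T) * Φ ((1 : ℝ) + y * Complex.I)) atTop
        (𝓝 (C * c + W T)) := by
    intro T c hc
    refine ((hc.const_mul (C : ℂ)).add (hW T)).congr fun R => ?_
    have hc1 : Continuous fun y : ℝ => Complex.exp ((((1 : ℝ) : ℂ) + y * Complex.I) * T) /
        (((1 : ℝ) : ℂ) + y * Complex.I) :=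
      Continuous.div (by fun_prop) (by fun_prop) (vertical_line_ne_zero one_ne_zero)
    have hc2 : Continuous fun y : ℝ => Complex.exp ((((1 : ℝ) : ℂ) + y * Complex.I) * T) *
        (Φ ((1 : ℝ) + y * Complex.I) - C / ((1 : ℝ) + y * Complex.I)) := by
      refine ((hcont T).sub (hc1.const_mul (C : ℂ))).congr fun y => ?_
      simp only [Pi.sub_apply]
      ring
    rw [← intervalIntegral.integral_const_mul, ← intervalIntegral.integral_add
      ((hc1.const_mul (C : ℂ)).intervalIntegrable _ _) (hc2.intervalIntegrable _ _)]
    refine intervalIntegral.integral_congr fun y _ => ?_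
    ring
  choose c hc using exists_tendsto_vertical_integral_exp_div one_pos
  -- The symmetry of `Φ` under conjugation makes every truncated integral real, hence the limit as
  -- well.
  have hreal : ∀ T : ℝ, (((C * c T + W T).re : ℝ) : ℂ) = C * c T + W T := by
    intro T
    have h1 := hlim T _ (hc T)
    have h2 := (Complex.continuous_ofReal.tendsto _).comp ((Complex.continuous_re.tendsto _).comp h1)
    refine tendsto_nhds_unique h2 (h1.congr fun R => ?_)
    simp only [Function.comp_apply]
    rw [intervalIntegral_eq_ofReal_of_conj (hcont T) ?_ R, Complex.ofReal_re]
    intro y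
    have e : ((1 : ℝ) : ℂ) + ((-y : ℝ) : ℂ) * Complex.I
        = (starRingEnd ℂ) (((1 : ℝ) : ℂ) + y * Complex.I) := by simp
    rw [e, hconj _ (by rw [hre]; exact one_pos), map_mul, ← Complex.exp_conj, map_mul,
      Complex.conj_ofReal]
  refine ⟨fun T => 1 / (2 * Real.pi) * (C * c T + W T).re, fun ε hε T => ?_, fun T hT => ?_, ?_⟩
  · have h1 := (hindep T ε hε _ (hlim T _ (hc T))).const_mul (1 / (2 * Real.pi) : ℂ)
    have e : ((1 / (2 * Real.pi) * (C * c T + W T).re : ℝ) : ℂ)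
        = 1 / (2 * Real.pi) * (C * c T + W T) := by
      rw [← hreal T]; push_cast; simp
    rw [e]
    exact h1
  · obtain ⟨K', hK'⟩ := hbound 1 one_pos T
    have h0 := tendsto_vertical_integral_of_neg one_pos hT (hd T) hK'
    beta_reduce
    rw [tendsto_nhds_unique (hlim T _ (hc T)) h0]
    simp
  · have h1 : Tendsto (fun T => 1 / (2 * Real.pi) * (C * (2 * Real.pi) + W T : ℂ).re) (𝓝[>] 0)
        (𝓝 (1 / (2 * Real.pi) * (C * (2 * Real.pi) + 0 : ℂ).re)) :=
      ((Complex.continuous_re.tendsto _).comp (hW0.const_add _)).const_mul _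
    have e : 1 / (2 * Real.pi) * (C * (2 * Real.pi) + 0 : ℂ).re = C := by
      have := Real.pi_pos
      rw [add_zero, Complex.re_ofReal_mul]
      simp
      field_simp
    rw [e] at h1
    refine h1.congr' ?_
    filter_upwards [self_mem_nhdsWithin] with T hT
    rw [tendsto_nhds_unique (hc T) (tendsto_vertical_integral_exp_div_of_pos one_pos hT)]

/-! ### The Green's function and its wavefront -/

/-- Writing `p t - κ(p)|x| = p (t - |x|/c) - q(p)|x|` splits off the travel time as a shift of `t`.
What remains behaves like `e^{-N|x|}/(2ρc p)` with error `O(1/p²)`, so the inversion theorem applies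
for each `x`. -/
theorem exists_isGreenFunction {ρ c N A : ℝ} (hρ : 0 < ρ) (hc : 0 < c) (hN : 0 ≤ N) (hA : 0 ≤ A)
    {q κ : ℂ → ℂ} (hq : DifferentiableOn ℂ q {z | 0 < z.re})
    (hqN : ∀ p : ℂ, 0 < p.re → ‖q p - N‖ ≤ A / ‖p‖)
    (hκ : ∀ p : ℂ, 0 < p.re → κ p = p / c + q p)
    (hconj : ∀ p : ℂ, 0 < p.re → q ((starRingEnd ℂ) p) = (starRingEnd ℂ) (q p)) :
    ∃ u : ℝ → ℝ → ℝ, IsGreenFunction ρ κ u ∧ ∀ x : ℝ, (∀ t : ℝ, t < |x| / c → u t x = 0) ∧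
      Tendsto (fun t : ℝ => u t x) (𝓝[>] (|x| / c)) (𝓝 (Real.exp (-N * |x|) / (2 * ρ * c))) := by
  have hp0 : ∀ p : ℂ, 0 < p.re → p ≠ 0 := by
    rintro p hp rfl
    simp at hp
  have hρ' : (ρ : ℂ) ≠ 0 := by exact_mod_cast hρ.ne'
  have hc' : (c : ℂ) ≠ 0 := by exact_mod_cast hc.ne'
  set Φ : ℝ → ℂ → ℂ := fun X p =>
    (1 / c + q p / p) * Complex.exp (-(q p * X)) / (2 * ρ * p) with hΦ
  have hΦd : ∀ X : ℝ, DifferentiableOn ℂ (Φ X) {z | 0 < z.re} := by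
    intro X
    refine DifferentiableOn.div (DifferentiableOn.mul
      ((hq.div (by fun_prop) fun p hp => hp0 p hp).const_add _) (hq.mul_const _).neg.cexp)
      (by fun_prop) fun p hp => ?_
    exact mul_ne_zero (mul_ne_zero two_ne_zero hρ') (hp0 p hp)
  have hΦc : ∀ X : ℝ, ∀ p : ℂ, 0 < p.re →
      Φ X ((starRingEnd ℂ) p) = (starRingEnd ℂ) (Φ X p) := by
    intro X p hp
    simp only [hΦ, hconj p hp, map_div₀, map_mul, map_add, map_one, Complex.conj_ofReal,
      ← Complex.exp_conj, map_neg, map_ofNat]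
  have hΦK : ∀ X : ℝ, 0 ≤ X → ∀ a : ℝ, 0 < a → ∃ K, ∀ p : ℂ, a ≤ p.re →
      ‖Φ X p - (Real.exp (-N * X) / (2 * ρ * c) : ℝ) / p‖ ≤ K / ‖p‖ ^ 2 := by
    intro X hX a ha
    set E : ℝ := Real.exp (X * A / a) with hE
    -- The first summand bounds the error of replacing `e^{-qX}` by `e^{-NX}`, the second the
    -- contribution of `q/p`; `E` bounds `|e^z|` on `Re p ≥ a`, where `z = -(q - N) X`.
    refine ⟨(1 / c * (X * A * E) + (N + A / a) * E) / (2 * ρ), fun p hp => ?_⟩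
    have hpn : a ≤ ‖p‖ := hp.trans (Complex.re_le_norm p)
    have hpp : 0 < ‖p‖ := ha.trans_le hpn
    have hne : p ≠ 0 := norm_pos_iff.1 hpp
    have hqn := hqN p (ha.trans_le hp)
    set z : ℂ := -((q p - N) * X) with hz
    have hzn : ‖z‖ ≤ X * A / ‖p‖ := by
      rw [hz, norm_neg, norm_mul, Complex.norm_real, Real.norm_of_nonneg hX]
      calc ‖q p - N‖ * X ≤ A / ‖p‖ * X := by gcongr
        _ = _ := by ring
    have hza : ‖z‖ ≤ X * A / a := hzn.trans (by gcongr)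
    have hez : ‖Complex.exp z‖ ≤ E := (Complex.norm_exp_le_exp_norm z).trans (Real.exp_le_exp.2 hza)
    have hez1 : ‖Complex.exp z - 1‖ ≤ X * A / ‖p‖ * E := by
      have h := Complex.norm_exp_sub_sum_le_norm_mul_exp z 1
      simp only [Finset.range_one, Finset.sum_singleton, pow_zero, Nat.factorial_zero,
        Nat.cast_one, div_one, pow_one] at h
      refine h.trans ?_
      have := Real.exp_le_exp.2 hza
      gcongr
    have hqa : ‖q p‖ ≤ N + A / a := by
      calc ‖q p‖ = ‖(N : ℂ) + (q p - N)‖ := by ring_nf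
        _ ≤ ‖(N : ℂ)‖ + ‖q p - N‖ := norm_add_le _ _
        _ ≤ N + A / a := by
          rw [Complex.norm_real, Real.norm_of_nonneg hN]
          gcongr
          exact hqn.trans (by gcongr)
    have hexp : Complex.exp (-(q p * X)) = (Real.exp (-N * X) : ℂ) * Complex.exp z := by
      rw [Complex.ofReal_exp, ← Complex.exp_add, hz]
      congr 1; push_cast; ring
    have hdecomp : Φ X p - (Real.exp (-N * X) / (2 * ρ * c) : ℝ) / p
        = (Real.exp (-N * X) : ℂ) * (1 / c * (Complex.exp z - 1) + q p / p * Complex.exp z)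
          / (2 * ρ * p) := by
      simp only [hΦ, hexp]
      push_cast
      field_simp
      ring
    have hexp1 : Real.exp (-N * X) ≤ 1 := Real.exp_le_one_iff.2 (by nlinarith [mul_nonneg hN hX])
    have hin : ‖1 / (c : ℂ) * (Complex.exp z - 1) + q p / p * Complex.exp z‖
        ≤ (1 / c * (X * A * E) + (N + A / a) * E) / ‖p‖ := by
      calc _ ≤ ‖1 / (c : ℂ) * (Complex.exp z - 1)‖ + ‖q p / p * Complex.exp z‖ := norm_add_le _ _
        _ = 1 / c * ‖Complex.exp z - 1‖ + ‖q p‖ / ‖p‖ * ‖Complex.exp z‖ := by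
          rw [norm_mul, norm_mul, norm_div, norm_div, Complex.norm_real, Real.norm_of_nonneg hc.le,
            norm_one]
        _ ≤ 1 / c * (X * A / ‖p‖ * E) + (N + A / a) / ‖p‖ * E := by gcongr
        _ = _ := by ring
    rw [hdecomp, norm_div, norm_mul, norm_mul, norm_mul, Complex.norm_real, Complex.norm_real,
      Real.norm_of_nonneg (Real.exp_nonneg _), Real.norm_of_nonneg hρ.le, Complex.norm_ofNat]
    calc _ ≤ 1 * ((1 / c * (X * A * E) + (N + A / a) * E) / ‖p‖) / (2 * ρ * ‖p‖) := by gcongr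
      _ = _ := by field_simp
  choose U hU hU0 hUlim using fun x : ℝ =>
    exists_inverse_laplace (hΦd |x|) (hΦc |x|) (hΦK |x| (abs_nonneg x))
  refine ⟨fun t x => U x (t - |x| / c), fun ε hε t x => ?_, fun x => ⟨fun t ht => ?_, ?_⟩⟩
  · refine (hU x ε hε (t - |x| / c)).congr fun R => ?_
    congr 1
    refine intervalIntegral.integral_congr fun y _ => ?_
    have hre : 0 < ((ε : ℂ) + y * Complex.I).re := by simpa using hε
    have hne := hp0 _ hre
    simp only [hΦ, hκ _ hre]
    generalize (ε : ℂ) + y * Complex.I = p at hne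
    have e : Complex.exp (p * t - (p / c + q p) * |x|)
        = Complex.exp (p * ((t - |x| / c : ℝ) : ℂ)) * Complex.exp (-(q p * |x|)) := by
      rw [← Complex.exp_add]
      congr 1; push_cast; ring
    rw [e]
    field_simp
  · exact hU0 x _ (by linarith)
  · refine (hUlim x).comp (tendsto_nhdsWithin_iff.2 ⟨?_, ?_⟩)
    · have hcont : Continuous fun t : ℝ => t - |x| / c := by fun_prop
      have := (hcont.tendsto (|x| / c)).mono_left (nhdsWithin_le_nhds (s := Ioi (|x| / c)))
      simpa using this
    · filter_upwards [self_mem_nhdsWithin] with t ht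
      exact mem_Ioi.2 (sub_pos.2 (mem_Ioi.1 ht))

theorem affineStieltjes_conj (γ : Measure ℝ) (J₀ m : ℝ) (p : ℂ) :
    affineStieltjes γ J₀ m ((starRingEnd ℂ) p) = (starRingEnd ℂ) (affineStieltjes γ J₀ m p) := by
  rw [affineStieltjes, affineStieltjes, stieltjesT_conj]
  simp

/-- The wavefront of a medium with `κ(p) = ρ^{1/2} p (J₀ + m ∫ γ(ds)/(p+s))^{1/2}`, where `γ` has
a finite first moment; then `κ(p) - p/c₀` differs from its limit by `O(1/p)`. -/
theorem exists_isGreenFunction_of_affineStieltjes {γ : Measure ℝ} [IsProbabilityMeasure γ]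
    (hγ : ∀ᵐ s ∂γ, 0 ≤ s) (hγ1 : Integrable (fun s : ℝ => s) γ) {ρ J₀ m : ℝ} (hρ : 0 < ρ)
    (hJ₀ : 0 < J₀) (hm : 0 ≤ m) {κ : ℂ → ℂ} (hκ : ∀ p : ℂ, 0 < p.re →
      κ p = Real.sqrt ρ * p * (affineStieltjes γ J₀ m p) ^ (1 / 2 : ℂ)) :
    ∃ u : ℝ → ℝ → ℝ, IsGreenFunction ρ κ u ∧ ∀ x : ℝ,
      (∀ t : ℝ, t < |x| / wavefrontSpeed ρ J₀ → u t x = 0) ∧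
      Tendsto (fun t : ℝ => u t x) (𝓝[>] (|x| / wavefrontSpeed ρ J₀))
        (𝓝 (Real.exp (-(m / (2 * wavefrontSpeed ρ J₀ * J₀)) * |x|) /
          (2 * ρ * wavefrontSpeed ρ J₀))) := by
  have hsJ : 0 < Real.sqrt J₀ := Real.sqrt_pos.2 hJ₀
  have hsρ : 0 < Real.sqrt ρ := Real.sqrt_pos.2 hρ
  have hc : 0 < wavefrontSpeed ρ J₀ := inv_pos.2 (Real.sqrt_pos.2 (mul_pos hρ hJ₀))
  have hμ1 : 0 ≤ ∫ s, s ∂γ := integral_nonneg_of_ae hγ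
  set r : ℂ → ℂ := fun p => affineStieltjes γ J₀ m p ^ (1 / 2 : ℂ) with hr
  have hN : m / (2 * wavefrontSpeed ρ J₀ * J₀) = Real.sqrt ρ * m / (2 * Real.sqrt J₀) := by
    rw [wavefrontSpeed, Real.sqrt_mul hρ.le]
    nth_rewrite 2 [← Real.sq_sqrt hJ₀.le]
    field_simp
  have hcinv : ((wavefrontSpeed ρ J₀ : ℝ) : ℂ)⁻¹ = Real.sqrt ρ * Real.sqrt J₀ := by
    rw [← Complex.ofReal_inv, inv_wavefrontSpeed, Real.sqrt_mul hρ.le]; push_cast; rfl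
  refine exists_isGreenFunction (q := fun p => Real.sqrt ρ * p * (r p - Real.sqrt J₀))
    -- The two summands estimate the two terms of `hdecomp` below: one through the first moment of
    -- `γ`, one through `|S| ≤ 1/|p|`, both with `|D| ≥ √J₀`.
    (A := Real.sqrt ρ * m * ((∫ s, s ∂γ) / Real.sqrt J₀ + m / (2 * Real.sqrt J₀ ^ 3)))
    hρ hc (by positivity) (by positivity) ?_ (fun p hp => ?_) (fun p hp => ?_) (fun p hp => ?_)
  · refine DifferentiableOn.mul (by fun_prop) (DifferentiableOn.sub_const ?_ _)
    exact ((differentiableOn_affineStieltjes hγ J₀ m).mono fun p hp => Or.inl hp).cpow_const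
      fun p hp => Or.inl (re_affineStieltjes_pos hγ hJ₀ hm hp)
  · have hp0 : p ≠ 0 := by rintro rfl; simp at hp
    have hpn : 0 < ‖p‖ := norm_pos_iff.2 hp0
    set S := stieltjesT γ p with hS
    set D : ℂ := r p + Real.sqrt J₀ with hD
    have hDn : Real.sqrt J₀ ≤ ‖D‖ := by
      refine le_trans ?_ (Complex.re_le_norm D)
      rw [hD, Complex.add_re, Complex.ofReal_re]
      have := re_cpow_half_nonneg (affineStieltjes γ J₀ m p)
      linarith
    have hD0 : D ≠ 0 := norm_pos_iff.1 (hsJ.trans_le hDn)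
    have hJ0 : (Real.sqrt J₀ : ℂ) ≠ 0 := by exact_mod_cast hsJ.ne'
    have hsq : (r p - Real.sqrt J₀) * D = m * S := by
      have h1 : r p ^ 2 = J₀ + m * S := cpow_half_sq _
      have h2 : (Real.sqrt J₀ : ℂ) ^ 2 = J₀ := by
        rw [← Complex.ofReal_pow, Real.sq_sqrt hJ₀.le]
      rw [hD]
      linear_combination h1 - h2
    have hsub : r p - Real.sqrt J₀ = m * S / D := by
      rw [eq_div_iff hD0, hsq]
    -- Since `r - √J₀ = mS/D`, the difference is `√ρ m (pS/D - 1/(2√J₀))`; expanding `1/(2√J₀) = 1/D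
    -- + mS/(2√J₀ D²)` leaves only terms of order `1/p`.
    have hdecomp : Real.sqrt ρ * p * (r p - Real.sqrt J₀)
        - (m / (2 * wavefrontSpeed ρ J₀ * J₀) : ℝ)
        = Real.sqrt ρ * m * ((p * S - 1) / D - m * S / (2 * Real.sqrt J₀ * D ^ 2)) := by
      have h2 : 2 * (Real.sqrt J₀ : ℂ) = D - m * S / D := by
        rw [← hsub, hD]; ring
      rw [hsub, hN]
      have h3 : 1 / (2 * (Real.sqrt J₀ : ℂ)) = 1 / D + m * S / (2 * Real.sqrt J₀ * D ^ 2) := by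
        have h4 : 2 * (Real.sqrt J₀ : ℂ) * D = D ^ 2 - m * S := by
          rw [h2, sub_mul, div_mul_cancel₀ _ hD0]; ring
        field_simp
        linear_combination -h4
      push_cast
      linear_combination (-(Real.sqrt ρ * m : ℂ)) * h3
    have hpS := norm_mul_stieltjesT_le hγ hp
    have hSn : ‖S‖ ≤ 1 / ‖p‖ := by
      rw [norm_mul] at hpS
      rw [le_div_iff₀ hpn]; linarith
    rw [hdecomp, norm_mul, norm_mul, Complex.norm_real, Complex.norm_real,
      Real.norm_of_nonneg hsρ.le, Real.norm_of_nonneg hm,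
      mul_div_assoc (Real.sqrt ρ * m)]
    refine mul_le_mul_of_nonneg_left ?_ (by positivity)
    refine (norm_sub_le _ _).trans ?_
    rw [norm_div, norm_div, norm_mul, norm_mul, norm_mul, norm_pow, Complex.norm_real,
      Complex.norm_real, Complex.norm_ofNat, Real.norm_of_nonneg hsJ.le, Real.norm_of_nonneg hm]
    have h1 := norm_mul_stieltjesT_sub_one_le hγ hγ1 hp
    calc ‖p * S - 1‖ / ‖D‖ + m * ‖S‖ / (2 * Real.sqrt J₀ * ‖D‖ ^ 2)
        ≤ ((∫ s, s ∂γ) / ‖p‖) / Real.sqrt J₀ +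
          m * (1 / ‖p‖) / (2 * Real.sqrt J₀ * Real.sqrt J₀ ^ 2) := by gcongr
      _ = _ := by field_simp
  · rw [hκ p hp, div_eq_mul_inv p, hcinv]
    ring
  · have hre := re_affineStieltjes_pos hγ hJ₀ hm hp
    have harg : (affineStieltjes γ J₀ m p).arg ≠ Real.pi :=
      (Complex.mem_slitPlane_iff_arg.1 (Or.inl hre)).1
    have : r ((starRingEnd ℂ) p) = (starRingEnd ℂ) (r p) := by
      simp only [hr]
      rw [affineStieltjes_conj, Complex.conj_cpow _ _ harg, map_div₀, map_one, map_ofNat]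
    simp only [this, map_mul, map_sub, Complex.conj_ofReal]

theorem mainTheorem2 (α ρ J₀ M₀ Ω c₀ N : ℝ) (hα : α ≤ 1) (hρ : 0 < ρ) (hJ₀ : 0 < J₀)
    (hM₀ : 0 ≤ M₀) (hΩ : 0 ≤ Ω) (hc₀ : c₀ = wavefrontSpeed ρ J₀)
    (hN : N = M₀ * Ω / (2 * c₀ * J₀)) :
    (∃ ν : MeasureTheory.Measure ℝ,
      IsAttenuationMeasure (wavenumber ρ (jlsCompliance α J₀ M₀ Ω)) c₀ ν) ∧
    (∀ ν : MeasureTheory.Measure ℝ,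
      IsAttenuationMeasure (wavenumber ρ (jlsCompliance α J₀ M₀ Ω)) c₀ ν →
        ν (Set.Ioi 0) = ENNReal.ofReal N ∧
        Filter.Tendsto (attenuation ν) Filter.atTop (nhds N) ∧
        (∀ ω : ℝ, 0 ≤ attenuation ν ω ∧ attenuation ν ω ≤ N) ∧
        Filter.Tendsto (relaxationKernel ν) (nhdsWithin 0 (Set.Ioi 0)) (nhds N)) ∧
    (∃ u : ℝ → ℝ → ℝ, IsGreenFunction ρ (wavenumber ρ (jlsCompliance α J₀ M₀ Ω)) u ∧
      ∀ x : ℝ,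
        (∀ t : ℝ, t < |x| / c₀ → u t x = 0) ∧
        Filter.Tendsto (fun t : ℝ => u t x) (nhdsWithin (|x| / c₀) (Set.Ioi (|x| / c₀)))
          (nhds (Real.exp (-N * |x|) / (2 * ρ * c₀)))) := by
  obtain ⟨γ, hprob, hγ, hγ1, hL⟩ := exists_measure_laplace_rpow hα hΩ
  have hm : 0 ≤ M₀ * Ω := mul_nonneg hM₀ hΩ
  have hκ : ∀ p : ℂ, 0 < p.re → wavenumber ρ (jlsCompliance α J₀ M₀ Ω) p
      = Real.sqrt ρ * p * (affineStieltjes γ J₀ (M₀ * Ω) p) ^ (1 / 2 : ℂ) := fun p hp => by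
    rw [wavenumber, mul_laplaceT_jlsCompliance hα hJ₀.le hM₀ hΩ hγ hL hp, affineStieltjes]
  have hcpos : 0 < wavefrontSpeed ρ J₀ := inv_pos.2 (Real.sqrt_pos.2 (mul_pos hρ hJ₀))
  subst hc₀
  have hN0 : 0 ≤ N := by rw [hN]; positivity
  refine ⟨exists_isAttenuationMeasure hγ hρ hJ₀ hm hκ, fun ν hν => ?_, ?_⟩
  · have hmass := hν.measure_Ioi hγ hρ hJ₀ hm hκ
    rw [← hN] at hmass
    exact ⟨hmass, tendsto_attenuation hN0 hmass, attenuation_mem_Icc hN0 hmass,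
      tendsto_relaxationKernel hN0 hmass⟩
  · rw [hN]
    exact exists_isGreenFunction_of_affineStieltjes hγ hγ1 hρ hJ₀ hm hκ
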